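/- **Lemma (refined Gårding inequality on $[0,\pi]$).** For every $A\ge 0$ there is a constant $M=M(A)$ such that the following holds. Let $c,\tilde c\in C^2[0,\pi]$ be real functions with $\|c^{(k)}\|_{L^\infty[0,\pi]},\|\tilde c^{(k)}\|_{L^\infty[0,\pi]}\le A$ for $k=0,1,2$, with $|c(\alpha)|\le A\alpha$, $|\tilde c(\alpha)|\le A\alpha$ on $[0,\pi]$, with $\operatorname{supp}c,\operatorname{supp}\tilde c\subset[0,\frac{\pi}{4}]$, and with $$9\,|c(\alpha)|\le\tilde c(\alpha)\qquad(\alpha\in[0,\pi]).$$ Let $f,g\in L^2[0,\pi]$ be real functions with $\operatorname{supp}f,\operatorname{supp}g\subset[0,\frac{\pi}{4}]$, and let $\epsilon>0$. Then both $$\int_0^\pi c(\alpha)f(\alpha)\int_0^\pi\frac{(\alpha-\beta)\epsilon}{((\alpha-\beta)^2+\epsilon^2)^2}\,(g(\alpha)-g(\beta))\,d\beta\,d\alpha$$ and $$\int_0^\pi c(\alpha)f(\alpha)\int_0^\pi\frac{1}{(\alpha-\beta)^2+\epsilon^2}\,(g(\alpha)-g(\beta))\,d\beta\,d\alpha$$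 are at most $$\int_0^\pi\tilde c(\alpha)f(\alpha)\int_0^\pi\frac{f(\alpha)-f(\beta)}{(\alpha-\beta)^2+\epsilon^2}\,d\beta\,d\alpha+\int_0^\pi\tilde c(\alpha)g(\alpha)\int_0^\pi\frac{g(\alpha)-g(\beta)}{(\alpha-\beta)^2+\epsilon^2}\,d\beta\,d\alpha+M\left(\|f\|_{L^2[0,\pi]}^2+\|g\|_{L^2[0,\pi]}^2\right).$$ In particular the constant $M$ does not depend on $\epsilon$, $f$ or $g$. -/

import Mathlib

open Real Set MeasureTheory

/-- The kernel `x ↦ x ε / (x² + ε²)²`. -/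
noncomputable def oddKernel (ε x : ℝ) : ℝ := x * ε / (x ^ 2 + ε ^ 2) ^ 2

/-- The kernel `x ↦ 1 / (x² + ε²)`. -/
noncomputable def evenKernel (ε x : ℝ) : ℝ := 1 / (x ^ 2 + ε ^ 2)

/-- The form `∫₀^π c(α) f(α) ∫₀^π K(α - β) (g(α) - g(β)) dβ dα`. -/
noncomputable def kernelForm (K c f g : ℝ → ℝ) : ℝ :=
  ∫ α in (0 : ℝ)..π, c α * f α * ∫ β in (0 : ℝ)..π, K (α - β) * (g α - g β)

/-- Admissible coefficients: `c ∈ C²[0,π]` with `C²` bounds at most `A` (one-sided derivatives at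
the end points), `|c(α)| ≤ A α` on `[0,π]`, and support in `[0,π/4]`. -/
structure IsCoeff (A : ℝ) (c : ℝ → ℝ) : Prop where
  contDiffOn : ContDiffOn ℝ 2 c (Icc 0 π)
  deriv_bound : ∀ k : ℕ, k ≤ 2 → ∀ x ∈ Icc (0 : ℝ) π, |iteratedDerivWithin k c (Icc 0 π) x| ≤ A
  linear_bound : ∀ x ∈ Icc (0 : ℝ) π, |c x| ≤ A * x
  support_subset : ∀ x ∈ Icc (0 : ℝ) π, c x ≠ 0 → x ∈ Icc (0 : ℝ) (π / 4)

/-- Real functions in `L²[0,π]` whose (essential) support lies in `[0,π/4]`. Only the values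
on `[0,π]` matter. -/
structure IsL2Supported (f : ℝ → ℝ) : Prop where
  memLp : MemLp f 2 (volume.restrict (Icc 0 π))
  support_subset : ∀ᵐ x ∂(volume.restrict (Icc (0 : ℝ) π)), f x ≠ 0 → x ∈ Icc (0 : ℝ) (π / 4)

/-!
The proof works on `(0, π]²` with the forms `T_K(F, G) = ∬ K(x - y) F(x) (G(x) - G(y))`, so that
`kernelForm K c f g = T_K(c f, g)`. Write `E` for the even and `O` for the odd kernel.

A coefficient `p ≥ 0` is distributed evenly over the two arguments: with `u = √p`,
`T_K(p f, g) = T_K(u f, u g) - ½ ∬ K (p(x) - p(y)) f(x) g(y) - ½ ∬ K (u(x) - u(y))² f(x) g(y)`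
(`differenceForm_mul_eq`), and both commutators are bounded on `L²` uniformly in `ε`.

* Since `p ≥ 0` has bounded second derivative, `u` is Lipschitz as a function of `√x`
  (`HasTaylorBound.sqrt_sub_sq_mul_le`). Hence `|K| (u(x) - u(y))²` is at most a multiple of
  Hilbert's kernel `1 / (x + y)`, and Schur's test applies. The growth of `u` like `√x` at the end
  point `0`, where `p` need only vanish linearly, is what makes Hilbert's kernel appear.
* For `K = O` the commutator with `p` is dominated by the Poisson kernel. For `K = E` it is, up to a
  bounded kernel, a smoothed Hilbert transform of `p' f` (`abs_integral_even_commutator_le`).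

It remains to compare `T_K(F, G)` with the energies `T_E(F, F)` and `T_E(G, G)`, where `F = u f` and
`G = u g`. For `K = E` this is the Cauchy–Schwarz inequality. For `K = O`, the kernels `2 O` and
`N(x) = (ε² - x²)/(x² + ε²)²` are the sine and cosine transforms of the same weight `ξ e^{-εξ} ≥ 0`,
so the form of `O` is dominated by that of `N` (`abs_integral_sin_kernel_le`; the same principle
with the weight `e^{-εξ}` bounds the Hilbert transform above). The form of `N` is in turn dominated
by the energy because `E + N = 2ε²/(x² + ε²)² ≥ 0` (`integral_conv_le_differenceForm`). The diagonal
terms that arise are bounded because `p(x) ≤ B x` and `p` vanishes on `(π/4, π]`.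

Altogether `|T_K(p f, g)| ≤ ½ (T_E(p f, f) + T_E(p g, g)) + O(‖f‖² + ‖g‖²)`
(`abs_differenceForm_mul_le`); in particular the energies are bounded below. The theorem follows
by applying this to `p, q = (c̃/9 ± c)/2`, for which `c = p - q` and `c̃ = 9 (p + q)`.
-/

/-! ### Bilinear forms with bounded kernels, and Schur's test -/

section BilinearForms

variable {μ : Measure ℝ} [IsFiniteMeasure μ] {k : ℝ × ℝ → ℝ} {C : ℝ} {f g : ℝ → ℝ}

lemma MeasureTheory.MemLp.integrable_of_two (hf : MemLp f 2 μ) : Integrable f μ :=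
  hf.integrable one_le_two

lemma integrable_kernel_mul_prod (hk : AEStronglyMeasurable k (μ.prod μ))
    (hC : ∀ᵐ z ∂(μ.prod μ), |k z| ≤ C) (hf : MemLp f 2 μ) (hg : MemLp g 2 μ) :
    Integrable (fun z : ℝ × ℝ => k z * (f z.1 * g z.2)) (μ.prod μ) :=
  (hf.integrable_of_two.mul_prod hg.integrable_of_two).bdd_mul hk hC

lemma integrable_kernel_mul_diag (hk : AEStronglyMeasurable k (μ.prod μ))
    (hC : ∀ᵐ z ∂(μ.prod μ), |k z| ≤ C) (hf : MemLp f 2 μ) (hg : MemLp g 2 μ) :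
    Integrable (fun z : ℝ × ℝ => k z * (f z.1 * g z.1)) (μ.prod μ) :=
  ((MemLp.integrable_mul hf hg).comp_fst μ).bdd_mul hk hC

/-- **Schur's test**: a kernel `k` with `k² ≤ a b`, where `a` is integrable in the second variable
and `b` in the first, uniformly in the other one, defines a bounded bilinear form on `L²`. -/
lemma abs_integral_kernel_le_of_schur {a b : ℝ × ℝ → ℝ} (ha : Measurable a) (hb : Measurable b)
    (ha0 : ∀ᵐ z ∂(μ.prod μ), 0 ≤ a z) (hb0 : ∀ᵐ z ∂(μ.prod μ), 0 ≤ b z)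
    (hk : ∀ᵐ z ∂(μ.prod μ), k z ^ 2 ≤ a z * b z) (hC : 0 ≤ C)
    (haC : ∀ᵐ x ∂μ, ∫⁻ y, ENNReal.ofReal (a (x, y)) ∂μ ≤ ENNReal.ofReal C)
    (hbC : ∀ᵐ y ∂μ, ∫⁻ x, ENNReal.ofReal (b (x, y)) ∂μ ≤ ENNReal.ofReal C)
    (hf : MemLp f 2 μ) (hg : MemLp g 2 μ) :
    |∫ z : ℝ × ℝ, k z * (f z.1 * g z.2) ∂(μ.prod μ)|
      ≤ C / 2 * ((∫ x, f x ^ 2 ∂μ) + ∫ x, g x ^ 2 ∂μ) := by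
  have hf2 := hf.integrable_sq
  have hg2 := hg.integrable_sq
  have hfm : AEMeasurable (fun x => ENNReal.ofReal (f x ^ 2)) μ := hf2.1.aemeasurable.ennreal_ofReal
  have hgm : AEMeasurable (fun x => ENNReal.ofReal (g x ^ 2)) μ := hg2.1.aemeasurable.ennreal_ofReal
  have hfm' : AEMeasurable (fun z : ℝ × ℝ => ENNReal.ofReal (f z.1 ^ 2)) (μ.prod μ) :=
    hfm.comp_quasiMeasurePreserving Measure.quasiMeasurePreserving_fst
  have hgm' : AEMeasurable (fun z : ℝ × ℝ => ENNReal.ofReal (g z.2 ^ 2)) (μ.prod μ) :=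
    hgm.comp_quasiMeasurePreserving Measure.quasiMeasurePreserving_snd
  have hA : ∫⁻ z : ℝ × ℝ, ENNReal.ofReal (f z.1 ^ 2) * ENNReal.ofReal (a z) ∂(μ.prod μ)
      ≤ ENNReal.ofReal C * ENNReal.ofReal (∫ x, f x ^ 2 ∂μ) := by
    rw [lintegral_prod _ (hfm'.fun_mul ha.ennreal_ofReal.aemeasurable),
      ofReal_integral_eq_lintegral_ofReal hf2 (Filter.Eventually.of_forall fun x => sq_nonneg _),
      ← lintegral_const_mul'' _ hfm]
    refine lintegral_mono_ae ?_
    filter_upwards [haC] with x hx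
    rw [lintegral_const_mul _ (by fun_prop), mul_comm]
    gcongr
  have hB : ∫⁻ z : ℝ × ℝ, ENNReal.ofReal (g z.2 ^ 2) * ENNReal.ofReal (b z) ∂(μ.prod μ)
      ≤ ENNReal.ofReal C * ENNReal.ofReal (∫ x, g x ^ 2 ∂μ) := by
    rw [lintegral_prod_symm _ (hgm'.fun_mul hb.ennreal_ofReal.aemeasurable),
      ofReal_integral_eq_lintegral_ofReal hg2 (Filter.Eventually.of_forall fun x => sq_nonneg _),
      ← lintegral_const_mul'' _ hgm]
    refine lintegral_mono_ae ?_
    filter_upwards [hbC] with x hx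
    rw [lintegral_const_mul _ (by fun_prop), mul_comm]
    gcongr
  have h2 : (0 : ℝ) ≤ 2⁻¹ := by norm_num
  have hF0 : 0 ≤ ∫ x, f x ^ 2 ∂μ := integral_nonneg fun x => sq_nonneg _
  have hG0 : 0 ≤ ∫ x, g x ^ 2 ∂μ := integral_nonneg fun x => sq_nonneg _
  have hmain : ‖∫ z : ℝ × ℝ, k z * (f z.1 * g z.2) ∂(μ.prod μ)‖ₑ
      ≤ ENNReal.ofReal (C / 2 * ((∫ x, f x ^ 2 ∂μ) + ∫ x, g x ^ 2 ∂μ)) := by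
    refine (enorm_integral_le_lintegral_enorm _).trans ?_
    calc ∫⁻ z : ℝ × ℝ, ‖k z * (f z.1 * g z.2)‖ₑ ∂(μ.prod μ)
        ≤ ∫⁻ z : ℝ × ℝ, ENNReal.ofReal 2⁻¹ * (ENNReal.ofReal (f z.1 ^ 2) * ENNReal.ofReal (a z)
            + ENNReal.ofReal (g z.2 ^ 2) * ENNReal.ofReal (b z)) ∂(μ.prod μ) := by
          refine lintegral_mono_ae ?_
          filter_upwards [ha0, hb0, hk] with z h1 h2' h3
          rw [← ENNReal.ofReal_mul (sq_nonneg _), ← ENNReal.ofReal_mul (sq_nonneg _),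
            ← ENNReal.ofReal_add (by positivity) (by positivity), ← ENNReal.ofReal_mul h2,
            Real.enorm_eq_ofReal_abs]
          refine ENNReal.ofReal_le_ofReal ?_
          refine abs_le_of_sq_le_sq ?_ (by positivity)
          have h4 : (k z * (f z.1 * g z.2)) ^ 2 ≤ a z * b z * (f z.1 * g z.2) ^ 2 := by
            rw [mul_pow]; gcongr
          nlinarith [sq_nonneg (f z.1 ^ 2 * a z - g z.2 ^ 2 * b z)]
      _ = ENNReal.ofReal 2⁻¹ * (∫⁻ z : ℝ × ℝ, ENNReal.ofReal (f z.1 ^ 2) * ENNReal.ofReal (a z)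
            ∂(μ.prod μ) + ∫⁻ z : ℝ × ℝ, ENNReal.ofReal (g z.2 ^ 2) * ENNReal.ofReal (b z)
            ∂(μ.prod μ)) := by
          rw [lintegral_const_mul' _ _ ENNReal.ofReal_ne_top,
            lintegral_add_left' (hfm'.fun_mul ha.ennreal_ofReal.aemeasurable)]
      _ ≤ ENNReal.ofReal 2⁻¹ * (ENNReal.ofReal C * ENNReal.ofReal (∫ x, f x ^ 2 ∂μ)
            + ENNReal.ofReal C * ENNReal.ofReal (∫ x, g x ^ 2 ∂μ)) := by gcongr
      _ = _ := by
          rw [← ENNReal.ofReal_mul hC, ← ENNReal.ofReal_mul hC,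
            ← ENNReal.ofReal_add (by positivity) (by positivity), ← ENNReal.ofReal_mul h2]
          congr 1; ring
  rw [Real.enorm_eq_ofReal_abs] at hmain
  exact (ENNReal.ofReal_le_ofReal_iff (by positivity)).1 hmain

end BilinearForms

/-! ### Positivity of Laplace–Fourier kernels -/

section Laplace

variable {μ : Measure ℝ} {F G : ℝ → ℝ}

lemma MeasureTheory.Integrable.mul_cos (hF : Integrable F μ) (ξ : ℝ) :
    Integrable (fun x => F x * cos (ξ * x)) μ :=
  hF.mul_bdd (c := 1) (by fun_prop) (Filter.Eventually.of_forall fun x => abs_cos_le_one _)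

lemma MeasureTheory.Integrable.mul_sin (hF : Integrable F μ) (ξ : ℝ) :
    Integrable (fun x => F x * sin (ξ * x)) μ :=
  hF.mul_bdd (c := 1) (by fun_prop) (Filter.Eventually.of_forall fun x => abs_sin_le_one _)

variable [IsFiniteMeasure μ]

/-- At a single frequency the form is half of `|F̂ - i Ĝ|²`, with `F̂`, `Ĝ` the Fourier transforms
of `F dμ` and `G dμ`. -/
lemma integral_cos_add_sin_nonneg (hF : Integrable F μ) (hG : Integrable G μ) (ξ : ℝ) :
    0 ≤ ∫ z : ℝ × ℝ, (cos ((z.1 - z.2) * ξ) * (F z.1 * F z.2 + G z.1 * G z.2) / 2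
      + sin ((z.1 - z.2) * ξ) * (F z.1 * G z.2)) ∂(μ.prod μ) := by
  have h : (fun z : ℝ × ℝ => cos ((z.1 - z.2) * ξ) * (F z.1 * F z.2 + G z.1 * G z.2) / 2
      + sin ((z.1 - z.2) * ξ) * (F z.1 * G z.2)) = fun z : ℝ × ℝ =>
      2⁻¹ * ((F z.1 * cos (ξ * z.1)) * (F z.2 * cos (ξ * z.2)))
      + 2⁻¹ * ((F z.1 * sin (ξ * z.1)) * (F z.2 * sin (ξ * z.2)))
      + 2⁻¹ * ((G z.1 * cos (ξ * z.1)) * (G z.2 * cos (ξ * z.2)))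
      + 2⁻¹ * ((G z.1 * sin (ξ * z.1)) * (G z.2 * sin (ξ * z.2)))
      + (F z.1 * sin (ξ * z.1)) * (G z.2 * cos (ξ * z.2))
      - (F z.1 * cos (ξ * z.1)) * (G z.2 * sin (ξ * z.2)) := by
    funext z
    rw [show (z.1 - z.2) * ξ = ξ * z.1 - ξ * z.2 by ring, cos_sub, sin_sub]
    ring
  have hFc := hF.mul_cos ξ
  have hFs := hF.mul_sin ξ
  have hGc := hG.mul_cos ξ
  have hGs := hG.mul_sin ξ
  have i1 := (hFc.mul_prod hFc).const_mul 2⁻¹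
  have i2 := (hFs.mul_prod hFs).const_mul 2⁻¹
  have i3 := (hGc.mul_prod hGc).const_mul 2⁻¹
  have i4 := (hGs.mul_prod hGs).const_mul 2⁻¹
  have i5 := hFs.mul_prod hGc
  have i6 := hFc.mul_prod hGs
  rw [h, integral_sub ((((i1.fun_add i2).fun_add i3).fun_add i4).fun_add i5) i6,
    integral_add (((i1.fun_add i2).fun_add i3).fun_add i4) i5,
    integral_add ((i1.fun_add i2).fun_add i3) i4, integral_add (i1.fun_add i2) i3, integral_add i1 i2]
  simp only [integral_const_mul]
  rw [integral_prod_mul (fun x => F x * cos (ξ * x)) (fun x => F x * cos (ξ * x)),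
    integral_prod_mul (fun x => F x * sin (ξ * x)) (fun x => F x * sin (ξ * x)),
    integral_prod_mul (fun x => G x * cos (ξ * x)) (fun x => G x * cos (ξ * x)),
    integral_prod_mul (fun x => G x * sin (ξ * x)) (fun x => G x * sin (ξ * x)),
    integral_prod_mul (fun x => F x * sin (ξ * x)) (fun x => G x * cos (ξ * x)),
    integral_prod_mul (fun x => F x * cos (ξ * x)) (fun x => G x * sin (ξ * x))]
  nlinarith [sq_nonneg ((∫ x, F x * sin (ξ * x) ∂μ) + ∫ x, G x * cos (ξ * x) ∂μ),
    sq_nonneg ((∫ x, F x * cos (ξ * x) ∂μ) - ∫ x, G x * sin (ξ * x) ∂μ)]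

/-- If `c` and `s` are the cosine and sine transforms of a weight `w ≥ 0` on the half-line, the
form of the odd kernel `s` is dominated by that of the even kernel `c`. -/
lemma integral_cos_add_sin_kernel_nonneg {w c s : ℝ → ℝ} (hw0 : ∀ ξ ∈ Ioi (0 : ℝ), 0 ≤ w ξ)
    (hw : IntegrableOn w (Ioi 0)) (hc : ∀ x, ∫ ξ in Ioi (0 : ℝ), w ξ * cos (x * ξ) = c x)
    (hs : ∀ x, ∫ ξ in Ioi (0 : ℝ), w ξ * sin (x * ξ) = s x)
    (hF : Integrable F μ) (hG : Integrable G μ) :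
    0 ≤ ∫ z : ℝ × ℝ, (c (z.1 - z.2) * (F z.1 * F z.2 + G z.1 * G z.2) / 2
      + s (z.1 - z.2) * (F z.1 * G z.2)) ∂(μ.prod μ) := by
  have hwc : ∀ x, IntegrableOn (fun ξ => w ξ * cos (x * ξ)) (Ioi 0) := fun x =>
    hw.mul_bdd (c := 1) (by fun_prop) (Filter.Eventually.of_forall fun ξ => abs_cos_le_one _)
  have hws : ∀ x, IntegrableOn (fun ξ => w ξ * sin (x * ξ)) (Ioi 0) := fun x =>
    hw.mul_bdd (c := 1) (by fun_prop) (Filter.Eventually.of_forall fun ξ => abs_sin_le_one _)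
  have key : ∀ z : ℝ × ℝ, c (z.1 - z.2) * (F z.1 * F z.2 + G z.1 * G z.2) / 2
      + s (z.1 - z.2) * (F z.1 * G z.2) = ∫ ξ in Ioi (0 : ℝ), w ξ *
        (cos ((z.1 - z.2) * ξ) * (F z.1 * F z.2 + G z.1 * G z.2) / 2
        + sin ((z.1 - z.2) * ξ) * (F z.1 * G z.2)) := by
    intro z
    rw [← hc, ← hs, mul_div_assoc, ← integral_mul_const, ← integral_mul_const,
      ← integral_add ((hwc _).mul_const _) ((hws _).mul_const _)]
    congr 1; funext ξ; ring
  have h1 : Integrable (fun z : ℝ × ℝ => F z.1 * F z.2 + G z.1 * G z.2) (μ.prod μ) :=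
    (hF.mul_prod hF).add (hG.mul_prod hG)
  have h2 : Integrable (fun z : ℝ × ℝ => F z.1 * G z.2) (μ.prod μ) := hF.mul_prod hG
  have hint : Integrable (Function.uncurry fun (z : ℝ × ℝ) (ξ : ℝ) => w ξ *
        (cos ((z.1 - z.2) * ξ) * (F z.1 * F z.2 + G z.1 * G z.2) / 2
        + sin ((z.1 - z.2) * ξ) * (F z.1 * G z.2)))
      ((μ.prod μ).prod (volume.restrict (Ioi (0 : ℝ)))) := by
    have j1 := (h1.mul_prod hw).bdd_mul (c := 1)
      (f := fun q : (ℝ × ℝ) × ℝ => cos ((q.1.1 - q.1.2) * q.2)) (by fun_prop)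
      (Filter.Eventually.of_forall fun ξ => abs_cos_le_one _)
    have j2 := (h2.mul_prod hw).bdd_mul (c := 1)
      (f := fun q : (ℝ × ℝ) × ℝ => sin ((q.1.1 - q.1.2) * q.2)) (by fun_prop)
      (Filter.Eventually.of_forall fun ξ => abs_sin_le_one _)
    refine ((j1.const_mul 2⁻¹).add j2).congr (Filter.Eventually.of_forall fun q => ?_)
    simp only [Function.uncurry, Pi.add_apply]
    ring
  simp_rw [key]
  rw [integral_integral_swap hint]
  refine setIntegral_nonneg measurableSet_Ioi fun ξ hξ => ?_
  rw [integral_const_mul]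
  exact mul_nonneg (hw0 ξ hξ) (integral_cos_add_sin_nonneg hF hG ξ)

lemma abs_integral_sin_kernel_le {w c s : ℝ → ℝ} (hw0 : ∀ ξ ∈ Ioi (0 : ℝ), 0 ≤ w ξ)
    (hw : IntegrableOn w (Ioi 0)) (hc : ∀ x, ∫ ξ in Ioi (0 : ℝ), w ξ * cos (x * ξ) = c x)
    (hs : ∀ x, ∫ ξ in Ioi (0 : ℝ), w ξ * sin (x * ξ) = s x)
    {Cc Cs : ℝ} (hcm : Continuous c) (hsm : Continuous s) (hcC : ∀ x, |c x| ≤ Cc)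
    (hsC : ∀ x, |s x| ≤ Cs) (hF : MemLp F 2 μ) (hG : MemLp G 2 μ) :
    |∫ z : ℝ × ℝ, s (z.1 - z.2) * (F z.1 * G z.2) ∂(μ.prod μ)|
      ≤ ((∫ z : ℝ × ℝ, c (z.1 - z.2) * (F z.1 * F z.2) ∂(μ.prod μ))
        + ∫ z : ℝ × ℝ, c (z.1 - z.2) * (G z.1 * G z.2) ∂(μ.prod μ)) / 2 := by
  have iF := integrable_kernel_mul_prod (μ := μ) (k := fun z => c (z.1 - z.2)) (C := Cc)
    (by fun_prop) (Filter.Eventually.of_forall fun z => hcC _) hF hF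
  have iG := integrable_kernel_mul_prod (μ := μ) (k := fun z => c (z.1 - z.2)) (C := Cc)
    (by fun_prop) (Filter.Eventually.of_forall fun z => hcC _) hG hG
  have iS := integrable_kernel_mul_prod (μ := μ) (k := fun z => s (z.1 - z.2)) (C := Cs)
    (by fun_prop) (Filter.Eventually.of_forall fun z => hsC _) hF hG
  have e : ∀ t : ℝ, ∫ z : ℝ × ℝ, (2⁻¹ * (c (z.1 - z.2) * (F z.1 * F z.2))
      + 2⁻¹ * (c (z.1 - z.2) * (G z.1 * G z.2))
      + t * (s (z.1 - z.2) * (F z.1 * G z.2))) ∂(μ.prod μ)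
      = 2⁻¹ * (∫ z : ℝ × ℝ, c (z.1 - z.2) * (F z.1 * F z.2) ∂(μ.prod μ))
        + 2⁻¹ * (∫ z : ℝ × ℝ, c (z.1 - z.2) * (G z.1 * G z.2) ∂(μ.prod μ))
        + t * ∫ z : ℝ × ℝ, s (z.1 - z.2) * (F z.1 * G z.2) ∂(μ.prod μ) := by
    intro t
    rw [integral_add ((iF.const_mul _).fun_add (iG.const_mul _)) (iS.const_mul _),
      integral_add (iF.const_mul _) (iG.const_mul _)]
    simp only [integral_const_mul]
  have p1 := integral_cos_add_sin_kernel_nonneg hw0 hw hc hs hF.integrable_of_two hG.integrable_of_two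
  have p2 := integral_cos_add_sin_kernel_nonneg hw0 hw hc hs hF.integrable_of_two
    hG.neg.integrable_of_two
  have q1 := e 1
  have q2 := e (-1)
  have r1 : ∫ z : ℝ × ℝ, (c (z.1 - z.2) * (F z.1 * F z.2 + G z.1 * G z.2) / 2
      + s (z.1 - z.2) * (F z.1 * G z.2)) ∂(μ.prod μ) = _ := Eq.trans
    (integral_congr_ae (Filter.Eventually.of_forall fun z => by ring)) q1
  have r2 : ∫ z : ℝ × ℝ, (c (z.1 - z.2) * (F z.1 * F z.2 + (-G) z.1 * (-G) z.2) / 2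
      + s (z.1 - z.2) * (F z.1 * (-G) z.2)) ∂(μ.prod μ) = _ := Eq.trans
    (integral_congr_ae (Filter.Eventually.of_forall fun z => by
      simp only [Pi.neg_apply]; ring)) q2
  rw [r1] at p1
  rw [r2] at p2
  exact abs_le.2 ⟨by linarith, by linarith⟩

end Laplace

/-! ### Cosine and sine transforms of `e^{-εξ}` and `ξ e^{-εξ}` -/

section Transforms

variable {ε : ℝ}

lemma integrableOn_exp_weight (hε : 0 < ε) : IntegrableOn (fun ξ => exp (-ε * ξ)) (Ioi 0) :=
  integrableOn_exp_mul_Ioi (by linarith) 0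

lemma integrableOn_mul_exp_weight (hε : 0 < ε) :
    IntegrableOn (fun ξ => ξ * exp (-ε * ξ)) (Ioi 0) := by
  simpa using integrableOn_rpow_mul_exp_neg_mul_rpow (s := 1) (p := 1) (b := ε)
    (by norm_num) (by norm_num) hε

lemma complex_exp_eq_cos_add_sin (ε x ξ : ℝ) :
    Complex.exp ((-ε + x * Complex.I : ℂ) * ξ) =
      ((exp (-ε * ξ) * cos (x * ξ) : ℝ) : ℂ) + ((exp (-ε * ξ) * sin (x * ξ) : ℝ) : ℂ) * Complex.I := by
  rw [show (-ε + x * Complex.I : ℂ) * ξ = ((-ε * ξ : ℝ) : ℂ) + ((x * ξ : ℝ) : ℂ) * Complex.I by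
    push_cast; ring, Complex.exp_add, Complex.exp_mul_I]
  push_cast; ring

/-- Real and imaginary parts of the Laplace–Fourier transform of a weight `w`. -/
lemma integral_weight_cos_sin {w : ℝ → ℝ} (hw : IntegrableOn w (Ioi 0)) {x c s : ℝ}
    (h : ∫ ξ in Ioi (0 : ℝ), (((w ξ * cos (x * ξ) : ℝ) : ℂ)
      + ((w ξ * sin (x * ξ) : ℝ) : ℂ) * Complex.I) = (c : ℂ) + (s : ℂ) * Complex.I) :
    ∫ ξ in Ioi (0 : ℝ), w ξ * cos (x * ξ) = c ∧ ∫ ξ in Ioi (0 : ℝ), w ξ * sin (x * ξ) = s := by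
  have hc : IntegrableOn (fun ξ => w ξ * cos (x * ξ)) (Ioi 0) :=
    hw.mul_bdd (c := 1) (by fun_prop) (Filter.Eventually.of_forall fun ξ => abs_cos_le_one _)
  have hs : IntegrableOn (fun ξ => w ξ * sin (x * ξ)) (Ioi 0) :=
    hw.mul_bdd (c := 1) (by fun_prop) (Filter.Eventually.of_forall fun ξ => abs_sin_le_one _)
  rw [integral_add hc.ofReal (hs.ofReal.mul_const _), integral_mul_const] at h
  have h1 : ∫ ξ in Ioi (0 : ℝ), ((w ξ * cos (x * ξ) : ℝ) : ℂ)
      = ((∫ ξ in Ioi (0 : ℝ), w ξ * cos (x * ξ) : ℝ) : ℂ) := integral_ofReal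
  have h2 : ∫ ξ in Ioi (0 : ℝ), ((w ξ * sin (x * ξ) : ℝ) : ℂ)
      = ((∫ ξ in Ioi (0 : ℝ), w ξ * sin (x * ξ) : ℝ) : ℂ) := integral_ofReal
  rw [h1, h2] at h
  have hre := congrArg Complex.re h
  have him := congrArg Complex.im h
  simp only [Complex.add_re, Complex.add_im, Complex.ofReal_re, Complex.ofReal_im, Complex.mul_re,
    Complex.mul_im, Complex.I_re, Complex.I_im, mul_zero, mul_one, sub_zero, add_zero,
    zero_add] at hre him
  exact ⟨hre, him⟩

lemma neg_add_mul_I_ne_zero (hε : 0 < ε) (x : ℝ) : (-ε + x * Complex.I : ℂ) ≠ 0 := by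
  intro h
  have := congrArg Complex.re h
  simp at this
  exact hε.ne' this

lemma integral_exp_weight (hε : 0 < ε) (x : ℝ) :
    ∫ ξ in Ioi (0 : ℝ), exp (-ε * ξ) * cos (x * ξ) = ε / (x ^ 2 + ε ^ 2) ∧
      ∫ ξ in Ioi (0 : ℝ), exp (-ε * ξ) * sin (x * ξ) = x / (x ^ 2 + ε ^ 2) := by
  refine integral_weight_cos_sin (integrableOn_exp_weight hε) ?_
  simp_rw [← complex_exp_eq_cos_add_sin]
  rw [integral_exp_mul_complex_Ioi (by simp [hε])]
  have h1 := neg_add_mul_I_ne_zero hε x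
  have h2 : (x ^ 2 + ε ^ 2 : ℂ) ≠ 0 := by
    have : x ^ 2 + ε ^ 2 ≠ 0 := by positivity
    exact_mod_cast this
  push_cast
  simp only [mul_zero, Complex.exp_zero]
  field_simp
  ring_nf
  simp only [Complex.I_sq]
  ring

lemma integral_mul_exp_weight (hε : 0 < ε) (x : ℝ) :
    ∫ ξ in Ioi (0 : ℝ), ξ * exp (-ε * ξ) * cos (x * ξ) = (ε ^ 2 - x ^ 2) / (x ^ 2 + ε ^ 2) ^ 2 ∧
      ∫ ξ in Ioi (0 : ℝ), ξ * exp (-ε * ξ) * sin (x * ξ) = 2 * oddKernel ε x := by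
  refine integral_weight_cos_sin (integrableOn_mul_exp_weight hε) ?_
  set z : ℂ := -ε + x * Complex.I with hz
  have hz0 : z ≠ 0 := neg_add_mul_I_ne_zero hε x
  have hzre : z.re = -ε := by simp [hz]
  have e : ∀ ξ : ℝ, (((ξ * exp (-ε * ξ) * cos (x * ξ) : ℝ) : ℂ)
      + ((ξ * exp (-ε * ξ) * sin (x * ξ) : ℝ) : ℂ) * Complex.I) = ξ * Complex.exp (z * ξ) := by
    intro ξ
    rw [hz, complex_exp_eq_cos_add_sin]
    push_cast; ring
  simp_rw [e]
  have hnorm : ∀ ξ : ℝ, ‖Complex.exp (z * ξ)‖ = exp (-ε * ξ) := by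
    intro ξ
    rw [Complex.norm_exp]; congr 1; simp [hzre]
  have hint : IntegrableOn (fun ξ : ℝ => (ξ : ℂ) * Complex.exp (z * ξ)) (Ioi 0) := by
    refine Integrable.mono (integrableOn_mul_exp_weight hε) (by fun_prop) ?_
    refine Filter.Eventually.of_forall fun ξ => ?_
    rw [norm_mul, norm_mul, hnorm, Complex.norm_real, norm_of_nonneg (exp_pos _).le]
  have hder : ∀ ξ : ℝ, HasDerivAt (fun t : ℝ => (t / z - 1 / z ^ 2) * Complex.exp (z * t))
      (ξ * Complex.exp (z * ξ)) ξ := by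
    intro ξ
    have d0 : HasDerivAt (fun t : ℝ => (t : ℂ)) 1 ξ := Complex.ofRealCLM.hasDerivAt
    have d1 := (d0.div_const z).sub_const (1 / z ^ 2)
    have d2 := (d0.const_mul z).cexp
    refine HasDerivAt.congr_deriv (d1.mul d2) ?_
    field_simp
    ring
  have hlim : Filter.Tendsto (fun t : ℝ => (t / z - 1 / z ^ 2) * Complex.exp (z * t))
      Filter.atTop (nhds 0) := by
    rw [tendsto_zero_iff_norm_tendsto_zero]
    have l1 : Filter.Tendsto (fun t : ℝ => t * exp (-ε * t)) Filter.atTop (nhds 0) := by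
      simpa using tendsto_rpow_mul_exp_neg_mul_atTop_nhds_zero 1 ε hε
    have l0 : Filter.Tendsto (fun t : ℝ => exp (-ε * t)) Filter.atTop (nhds 0) := by
      simpa using tendsto_rpow_mul_exp_neg_mul_atTop_nhds_zero 0 ε hε
    have l2 := (l1.mul_const ‖z‖⁻¹).add (l0.mul_const (‖1 / z ^ 2‖))
    simp only [zero_mul, add_zero] at l2
    refine squeeze_zero' (Filter.Eventually.of_forall fun t => norm_nonneg _) ?_ l2
    filter_upwards [Filter.eventually_ge_atTop 0] with t ht
    rw [norm_mul, hnorm]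
    calc ‖(t : ℂ) / z - 1 / z ^ 2‖ * exp (-ε * t)
        ≤ (‖(t : ℂ) / z‖ + ‖1 / z ^ 2‖) * exp (-ε * t) := by
          gcongr; exact norm_sub_le _ _
      _ = _ := by
          rw [norm_div, Complex.norm_real, norm_of_nonneg ht]; ring
  rw [integral_Ioi_of_hasDerivAt_of_tendsto' (fun ξ _ => hder ξ) hint hlim]
  have h2 : (x ^ 2 + ε ^ 2 : ℂ) ≠ 0 := by
    have : x ^ 2 + ε ^ 2 ≠ 0 := by positivity
    exact_mod_cast this
  have hconj : z * (-ε - x * Complex.I) = x ^ 2 + ε ^ 2 := by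
    rw [hz]; ring_nf; simp only [Complex.I_sq]; ring
  have hinv : 1 / z = (-ε - x * Complex.I) / (x ^ 2 + ε ^ 2) := by
    rw [div_eq_div_iff hz0 h2, mul_comm _ z, hconj, one_mul]
  have : (1 / z ^ 2 : ℂ) = (1 / z) ^ 2 := by rw [one_div_pow]
  simp only [this, hinv, oddKernel]
  push_cast
  simp only [zero_div, zero_sub, mul_zero, Complex.exp_zero, mul_one, sub_neg_eq_add, zero_add]
  field_simp
  ring_nf
  simp only [Complex.I_sq]
  ring

end Transforms

/-! ### Elementary bounds on the kernels -/

section Kernels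

variable {ε : ℝ}

lemma continuous_evenKernel (hε : 0 < ε) : Continuous (evenKernel ε) := by
  unfold evenKernel
  exact continuous_const.div (by fun_prop) fun x => by positivity

lemma continuous_oddKernel (hε : 0 < ε) : Continuous (oddKernel ε) := by
  unfold oddKernel
  exact Continuous.div (by fun_prop) (by fun_prop) fun x => by positivity

lemma evenKernel_nonneg (ε x : ℝ) : 0 ≤ evenKernel ε x := by
  unfold evenKernel; positivity

lemma evenKernel_neg (ε x : ℝ) : evenKernel ε (-x) = evenKernel ε x := by
  simp [evenKernel]

lemma abs_evenKernel_le (hε : 0 < ε) (x : ℝ) : |evenKernel ε x| ≤ 1 / ε ^ 2 := by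
  rw [abs_of_nonneg (evenKernel_nonneg ε x), evenKernel]
  exact one_div_le_one_div_of_le (by positivity) (by nlinarith [sq_nonneg x])

lemma abs_oddKernel_le_evenKernel (hε : 0 < ε) (x : ℝ) : |oddKernel ε x| ≤ evenKernel ε x := by
  have h : 0 < x ^ 2 + ε ^ 2 := by positivity
  rw [oddKernel, evenKernel, abs_div, abs_of_pos (pow_pos h 2), div_le_div_iff₀ (by positivity) h,
    abs_mul, abs_of_pos hε]
  have : |x| * ε ≤ x ^ 2 + ε ^ 2 := by nlinarith [sq_nonneg (|x| - ε), sq_abs x, abs_nonneg x]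
  nlinarith

lemma evenKernel_mul_sq_le (hε : 0 < ε) (x : ℝ) : evenKernel ε x * x ^ 2 ≤ 1 := by
  rw [evenKernel, one_div_mul_eq_div, div_le_one (by positivity)]
  nlinarith [sq_nonneg ε]

lemma abs_oddKernel_mul_abs_le (hε : 0 < ε) (x : ℝ) :
    |oddKernel ε x| * |x| ≤ ε / (x ^ 2 + ε ^ 2) := by
  have h : 0 < x ^ 2 + ε ^ 2 := by positivity
  rw [oddKernel, abs_div, abs_of_pos (pow_pos h 2), abs_mul, abs_of_pos hε, div_mul_eq_mul_div,
    div_le_div_iff₀ (by positivity) h, show |x| * ε * |x| = ε * x ^ 2 by rw [← sq_abs x]; ring]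
  have : ε * x ^ 2 ≤ ε * (x ^ 2 + ε ^ 2) := by gcongr; nlinarith [sq_nonneg ε]
  nlinarith

lemma hasDerivAt_sub_div (hε : 0 < ε) (x y : ℝ) :
    HasDerivAt (fun y => (x - y) / ((x - y) ^ 2 + ε ^ 2))
      (((x - y) ^ 2 - ε ^ 2) / ((x - y) ^ 2 + ε ^ 2) ^ 2) y := by
  have d0 : HasDerivAt (fun y => x - y) (-1) y := by simpa using (hasDerivAt_id y).const_sub x
  have h : (x - y) ^ 2 + ε ^ 2 ≠ 0 := by positivity
  refine HasDerivAt.congr_deriv (d0.div ((d0.pow 2).add_const (ε ^ 2)) h) ?_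
  field_simp
  push_cast
  ring

lemma hasDerivAt_half_div (hε : 0 < ε) (x y : ℝ) :
    HasDerivAt (fun y => ε / 2 / ((x - y) ^ 2 + ε ^ 2)) (oddKernel ε (x - y)) y := by
  have d0 : HasDerivAt (fun y => x - y) (-1) y := by simpa using (hasDerivAt_id y).const_sub x
  have h : (x - y) ^ 2 + ε ^ 2 ≠ 0 := by positivity
  unfold oddKernel
  refine HasDerivAt.congr_deriv ((hasDerivAt_const y (ε / 2)).div ((d0.pow 2).add_const (ε ^ 2)) h) ?_
  field_simp
  push_cast
  ring

lemma setIntegral_oddKernel (hε : 0 < ε) (x : ℝ) :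
    ∫ y in Ioc (0 : ℝ) π, oddKernel ε (x - y)
      = ε / 2 / ((x - π) ^ 2 + ε ^ 2) - ε / 2 / (x ^ 2 + ε ^ 2) := by
  rw [← intervalIntegral.integral_of_le pi_pos.le,
    intervalIntegral.integral_eq_sub_of_hasDerivAt (fun y _ => hasDerivAt_half_div hε x y)
      (((continuous_oddKernel hε).comp (by fun_prop)).intervalIntegrable _ _), sub_zero]

lemma continuous_sq_sub_div (hε : 0 < ε) :
    Continuous fun x : ℝ => (x ^ 2 - ε ^ 2) / (x ^ 2 + ε ^ 2) ^ 2 :=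
  Continuous.div (by fun_prop) (by fun_prop) fun x => by positivity

lemma setIntegral_sq_sub_div (hε : 0 < ε) (x : ℝ) :
    ∫ y in Ioc (0 : ℝ) π, ((x - y) ^ 2 - ε ^ 2) / ((x - y) ^ 2 + ε ^ 2) ^ 2
      = (x - π) / ((x - π) ^ 2 + ε ^ 2) - x / (x ^ 2 + ε ^ 2) := by
  rw [← intervalIntegral.integral_of_le pi_pos.le,
    intervalIntegral.integral_eq_sub_of_hasDerivAt (fun y _ => hasDerivAt_sub_div hε x y)
      (((continuous_sq_sub_div hε).comp (by fun_prop : Continuous fun y : ℝ => x - y)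
        ).intervalIntegrable _ _), sub_zero]

lemma continuous_poissonKernel (hε : 0 < ε) : Continuous fun x : ℝ => ε / (x ^ 2 + ε ^ 2) :=
  Continuous.div (by fun_prop) (by fun_prop) fun x => by positivity

lemma setIntegral_poissonKernel_le (hε : 0 < ε) (x : ℝ) :
    ∫ y in Ioc (0 : ℝ) π, ε / ((x - y) ^ 2 + ε ^ 2) ≤ π := by
  have hd : ∀ y : ℝ, HasDerivAt (fun y => -arctan ((x - y) / ε)) (ε / ((x - y) ^ 2 + ε ^ 2)) y := by
    intro y
    have d0 : HasDerivAt (fun y => (x - y) / ε) (-1 / ε) y := by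
      simpa using ((hasDerivAt_id y).const_sub x).div_const ε
    refine HasDerivAt.congr_deriv (d0.arctan.neg) ?_
    have h : (x - y) ^ 2 + ε ^ 2 ≠ 0 := by positivity
    have h' : ε ^ 2 + (x - y) ^ 2 ≠ 0 := by positivity
    field_simp
    ring
  rw [← intervalIntegral.integral_of_le pi_pos.le,
    intervalIntegral.integral_eq_sub_of_hasDerivAt (fun y _ => hd y)
      (((continuous_poissonKernel hε).comp (by fun_prop : Continuous fun y : ℝ => x - y)
        ).intervalIntegrable _ _)]
  linarith [arctan_lt_pi_div_two ((x - 0) / ε), neg_pi_div_two_lt_arctan ((x - π) / ε)]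

lemma lintegral_poissonKernel_le (hε : 0 < ε) (x : ℝ) :
    ∫⁻ y, ENNReal.ofReal (ε / ((x - y) ^ 2 + ε ^ 2)) ∂(volume.restrict (Ioc 0 π))
      ≤ ENNReal.ofReal π := by
  rw [← ofReal_integral_eq_lintegral_ofReal]
  · exact ENNReal.ofReal_le_ofReal (setIntegral_poissonKernel_le hε x)
  · exact ((continuous_poissonKernel hε).comp (by fun_prop : Continuous fun y : ℝ => x - y)
      ).integrableOn_Ioc
  · exact Filter.Eventually.of_forall fun y => by positivity

/-- The Schur bound for Hilbert's kernel `1 / (x + y)` with weight `x ^ (-1/2)`. -/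
lemma lintegral_hilbertKernel_le {x : ℝ} (hx : 0 < x) :
    ∫⁻ y, ENNReal.ofReal (√x / (√y * (x + y))) ∂(volume.restrict (Ioc 0 π)) ≤ ENNReal.ofReal π := by
  have hsx : 0 < √x := sqrt_pos.2 hx
  have hcont : ContinuousOn (fun y => 2 * arctan (√y / √x)) (Icc 0 π) := by fun_prop
  have hd : ∀ y ∈ Ioo 0 π, HasDerivAt (fun y => 2 * arctan (√y / √x)) (√x / (√y * (x + y))) y := by
    intro y hy
    have hsy : 0 < √y := sqrt_pos.2 hy.1
    refine HasDerivAt.congr_deriv (((hasDerivAt_sqrt hy.1.ne').div_const √x).arctan.const_mul 2) ?_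
    rw [div_pow, sq_sqrt hx.le, sq_sqrt hy.1.le]
    have h1 : x + y ≠ 0 := by have := hy.1; positivity
    field_simp
    rw [sq_sqrt hx.le]
  have hint := intervalIntegral.integrableOn_deriv_of_nonneg hcont hd
    (fun y hy => by have := hy.1; positivity)
  rw [← ofReal_integral_eq_lintegral_ofReal hint]
  · refine ENNReal.ofReal_le_ofReal ?_
    rw [← intervalIntegral.integral_of_le pi_pos.le,
      intervalIntegral.integral_eq_sub_of_hasDerivAt_of_le pi_pos.le hcont hd
      ((intervalIntegrable_iff_integrableOn_Ioc_of_le pi_pos.le).2 hint)]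
    simp only [sqrt_zero, zero_div, arctan_zero]
    linarith [arctan_lt_pi_div_two (√π / √x)]
  · refine (ae_restrict_iff' measurableSet_Ioc).2 (Filter.Eventually.of_forall fun y hy => ?_)
    have := hy.1
    positivity

end Kernels

/-! ### Difference forms -/

/-- The form `∬ K(x - y) F(x) (G(x) - G(y)) dμ(x) dμ(y)`, as a single integral against `μ × μ`. -/
noncomputable def differenceForm (μ : Measure ℝ) (K F G : ℝ → ℝ) : ℝ :=
  ∫ z : ℝ × ℝ, K (z.1 - z.2) * (F z.1 * (G z.1 - G z.2)) ∂(μ.prod μ)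

section DifferenceForm

variable {μ : Measure ℝ} [IsFiniteMeasure μ] {K F G : ℝ → ℝ} {C : ℝ}

lemma integrable_conv_mul_prod (hK : Continuous K) (hC : ∀ x, |K x| ≤ C) (hF : MemLp F 2 μ)
    (hG : MemLp G 2 μ) :
    Integrable (fun z : ℝ × ℝ => K (z.1 - z.2) * (F z.1 * G z.2)) (μ.prod μ) :=
  integrable_kernel_mul_prod (C := C) (by fun_prop) (Filter.Eventually.of_forall fun _ => hC _) hF hG

lemma integrable_conv_mul_diag (hK : Continuous K) (hC : ∀ x, |K x| ≤ C) (hF : MemLp F 2 μ)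
    (hG : MemLp G 2 μ) :
    Integrable (fun z : ℝ × ℝ => K (z.1 - z.2) * (F z.1 * G z.1)) (μ.prod μ) :=
  integrable_kernel_mul_diag (C := C) (by fun_prop) (Filter.Eventually.of_forall fun _ => hC _) hF hG

lemma integrable_differenceForm (hK : Continuous K) (hC : ∀ x, |K x| ≤ C) (hF : MemLp F 2 μ)
    (hG : MemLp G 2 μ) :
    Integrable (fun z : ℝ × ℝ => K (z.1 - z.2) * (F z.1 * (G z.1 - G z.2))) (μ.prod μ) :=
  ((integrable_conv_mul_diag hK hC hF hG).sub (integrable_conv_mul_prod hK hC hF hG)).congr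
    (Filter.Eventually.of_forall fun z => by simp only [Pi.sub_apply]; ring)

lemma differenceForm_eq_sub (hK : Continuous K) (hC : ∀ x, |K x| ≤ C) (hF : MemLp F 2 μ)
    (hG : MemLp G 2 μ) :
    differenceForm μ K F G = (∫ z : ℝ × ℝ, K (z.1 - z.2) * (F z.1 * G z.1) ∂(μ.prod μ))
      - ∫ z : ℝ × ℝ, K (z.1 - z.2) * (F z.1 * G z.2) ∂(μ.prod μ) := by
  rw [← integral_sub (integrable_conv_mul_diag hK hC hF hG) (integrable_conv_mul_prod hK hC hF hG)]
  exact integral_congr_ae (Filter.Eventually.of_forall fun z => by dsimp only; ring)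

lemma differenceForm_add_kernel {K' : ℝ → ℝ} {C' : ℝ} (hK : Continuous K) (hC : ∀ x, |K x| ≤ C)
    (hK' : Continuous K') (hC' : ∀ x, |K' x| ≤ C') (hF : MemLp F 2 μ) (hG : MemLp G 2 μ) :
    differenceForm μ (fun x => K x + K' x) F G
      = differenceForm μ K F G + differenceForm μ K' F G := by
  unfold differenceForm
  rw [← integral_add (integrable_differenceForm hK hC hF hG)
    (integrable_differenceForm hK' hC' hF hG)]
  exact integral_congr_ae (Filter.Eventually.of_forall fun z => by dsimp only; ring)

/-- Symmetrization in the two variables. -/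
lemma integrable_and_differenceForm_eq_symm (hK : Continuous K) (hC : ∀ x, |K x| ≤ C)
    (hev : ∀ x, K (-x) = K x) (hF : MemLp F 2 μ) (hG : MemLp G 2 μ) :
    Integrable (fun z : ℝ × ℝ => K (z.1 - z.2) * ((F z.1 - F z.2) * (G z.1 - G z.2))) (μ.prod μ) ∧
    differenceForm μ K F G
      = (∫ z : ℝ × ℝ, K (z.1 - z.2) * ((F z.1 - F z.2) * (G z.1 - G z.2)) ∂(μ.prod μ)) / 2 := by
  have hi := integrable_differenceForm hK hC hF hG
  have hs : ∫ z : ℝ × ℝ, K (z.2 - z.1) * (F z.2 * (G z.2 - G z.1)) ∂(μ.prod μ)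
      = differenceForm μ K F G :=
    integral_prod_swap (fun z : ℝ × ℝ => K (z.1 - z.2) * (F z.1 * (G z.1 - G z.2)))
  have his : Integrable (fun z : ℝ × ℝ => K (z.2 - z.1) * (F z.2 * (G z.2 - G z.1))) (μ.prod μ) :=
    hi.swap
  have e : (fun z : ℝ × ℝ => K (z.1 - z.2) * ((F z.1 - F z.2) * (G z.1 - G z.2)))
      = fun z => K (z.1 - z.2) * (F z.1 * (G z.1 - G z.2))
        + K (z.2 - z.1) * (F z.2 * (G z.2 - G z.1)) := by
    funext z
    rw [← hev (z.2 - z.1), neg_sub]; ring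
  rw [e]
  refine ⟨hi.add his, ?_⟩
  rw [integral_add hi his, hs]
  unfold differenceForm; ring

lemma differenceForm_self_nonneg (hK : Continuous K) (hC : ∀ x, |K x| ≤ C)
    (hev : ∀ x, K (-x) = K x) (h0 : ∀ x, 0 ≤ K x) (hF : MemLp F 2 μ) :
    0 ≤ differenceForm μ K F F := by
  rw [(integrable_and_differenceForm_eq_symm hK hC hev hF hF).2]
  exact div_nonneg (integral_nonneg fun z => mul_nonneg (h0 _) (mul_self_nonneg _)) zero_le_two

lemma abs_differenceForm_le (hK : Continuous K) (hC : ∀ x, |K x| ≤ C)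
    (hev : ∀ x, K (-x) = K x) (h0 : ∀ x, 0 ≤ K x) (hF : MemLp F 2 μ) (hG : MemLp G 2 μ) :
    |differenceForm μ K F G| ≤ (differenceForm μ K F F + differenceForm μ K G G) / 2 := by
  obtain ⟨iFF, eFF⟩ := integrable_and_differenceForm_eq_symm hK hC hev hF hF
  obtain ⟨iGG, eGG⟩ := integrable_and_differenceForm_eq_symm hK hC hev hG hG
  rw [(integrable_and_differenceForm_eq_symm hK hC hev hF hG).2, eFF, eGG, abs_div, abs_two,
    ← add_div, ← integral_add iFF iGG]
  have h := norm_integral_le_of_norm_le ((iFF.add iGG).div_const 2)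
    (f := fun z : ℝ × ℝ => K (z.1 - z.2) * ((F z.1 - F z.2) * (G z.1 - G z.2)))
    (Filter.Eventually.of_forall fun z => by
      rw [norm_mul, Real.norm_of_nonneg (h0 _), Real.norm_eq_abs, Pi.add_apply, ← mul_add,
        mul_div_assoc]
      refine mul_le_mul_of_nonneg_left ?_ (h0 _)
      rw [abs_le]
      constructor <;> nlinarith [sq_nonneg (F z.1 - F z.2 - (G z.1 - G z.2)),
        sq_nonneg (F z.1 - F z.2 + (G z.1 - G z.2))])
  rw [integral_div] at h
  exact div_le_div_of_nonneg_right h zero_le_two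

end DifferenceForm

/-! ### The forms of the two kernels on `(0, π]` -/

/-- Lebesgue measure on `(0, π]`. -/
noncomputable abbrev arcMeasure : Measure ℝ := volume.restrict (Ioc 0 π)

lemma ae_prod_arcMeasure {P : ℝ × ℝ → Prop}
    (h : ∀ x ∈ Ioc 0 π, ∀ y ∈ Ioc 0 π, P (x, y)) : ∀ᵐ z ∂(arcMeasure.prod arcMeasure), P z := by
  rw [Measure.prod_restrict, ae_restrict_iff' (measurableSet_Ioc.prod measurableSet_Ioc)]
  exact Filter.Eventually.of_forall fun z hz => h z.1 hz.1 z.2 hz.2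

section ArcForms

variable {K F G f g u : ℝ → ℝ} {C B ε : ℝ}

lemma abs_integral_diag_le (hK : Continuous K) (hC : ∀ x, |K x| ≤ C)
    (hF : MemLp F 2 arcMeasure) (hG : MemLp G 2 arcMeasure) (hf : MemLp f 2 arcMeasure)
    (hg : MemLp g 2 arcMeasure) (hB : 0 ≤ B)
    (h : ∀ x ∈ Ioc 0 π, |F x * G x| * |∫ y, K (x - y) ∂arcMeasure| ≤ B * |f x * g x|) :
    |∫ z : ℝ × ℝ, K (z.1 - z.2) * (F z.1 * G z.1) ∂(arcMeasure.prod arcMeasure)|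
      ≤ B / 2 * ((∫ x, f x ^ 2 ∂arcMeasure) + ∫ x, g x ^ 2 ∂arcMeasure) := by
  rw [integral_prod _ (integrable_conv_mul_diag hK hC hF hG), ← integral_add hf.integrable_sq
    hg.integrable_sq, ← integral_const_mul, ← Real.norm_eq_abs]
  refine norm_integral_le_of_norm_le ((hf.integrable_sq.add hg.integrable_sq).const_mul _) ?_
  refine (ae_restrict_iff' measurableSet_Ioc).2 (Filter.Eventually.of_forall fun x hx => ?_)
  dsimp only
  rw [integral_mul_const, Real.norm_eq_abs, mul_comm, abs_mul]
  refine (h x hx).trans ?_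
  rw [div_mul_eq_mul_div, mul_div_assoc]
  refine mul_le_mul_of_nonneg_left ?_ hB
  rw [abs_mul]
  nlinarith [sq_nonneg (|f x| - |g x|), sq_abs (f x), sq_abs (g x)]

lemma abs_sq_sub_div_le (hε : 0 < ε) (x : ℝ) :
    |(x ^ 2 - ε ^ 2) / (x ^ 2 + ε ^ 2) ^ 2| ≤ 1 / ε ^ 2 := by
  refine le_trans ?_ (abs_evenKernel_le hε x)
  have h : 0 < x ^ 2 + ε ^ 2 := by positivity
  rw [abs_of_nonneg (evenKernel_nonneg ε x), evenKernel, abs_div, abs_of_pos (pow_pos h 2),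
    div_le_div_iff₀ (by positivity) h]
  have : |x ^ 2 - ε ^ 2| ≤ x ^ 2 + ε ^ 2 := by
    rw [abs_le]; constructor <;> nlinarith [sq_nonneg x, sq_nonneg ε]
  nlinarith

/-- The kernel `(ε² - x²)/(x² + ε²)²` is the cosine transform of `ξ e^{-εξ}`. Its form is dominated
by the energy, because adding `1/(x² + ε²)` to it leaves the nonnegative kernel
`2ε²/(x² + ε²)²`; the diagonal term is harmless where the coefficient `u²` vanishes linearly. -/
lemma integral_conv_le_differenceForm (hε : 0 < ε) (hB : 0 ≤ B)
    (hu : ∀ x ∈ Ioc 0 π, u x ^ 2 ≤ B * x) (hs : ∀ x ∈ Ioc 0 π, π / 4 < x → u x = 0)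
    (hf : MemLp f 2 arcMeasure) (hF : MemLp (fun x => u x * f x) 2 arcMeasure) :
    ∫ z : ℝ × ℝ, (ε ^ 2 - (z.1 - z.2) ^ 2) / ((z.1 - z.2) ^ 2 + ε ^ 2) ^ 2
        * ((u z.1 * f z.1) * (u z.2 * f z.2)) ∂(arcMeasure.prod arcMeasure)
      ≤ differenceForm arcMeasure (evenKernel ε) (fun x => u x * f x) (fun x => u x * f x)
        + 2 * B * ∫ x, f x ^ 2 ∂arcMeasure := by
  set F := fun x => u x * f x with hFdef
  set K₁ : ℝ → ℝ := fun x => (x ^ 2 - ε ^ 2) / (x ^ 2 + ε ^ 2) ^ 2 with hK₁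
  set K₂ : ℝ → ℝ := fun x => 2 * ε ^ 2 * evenKernel ε x ^ 2 with hK₂
  have c1 : Continuous K₁ := continuous_sq_sub_div hε
  have b1 : ∀ x, |K₁ x| ≤ 1 / ε ^ 2 := abs_sq_sub_div_le hε
  have c2 : Continuous K₂ := ((continuous_evenKernel hε).pow 2).const_mul _
  have p2 : ∀ x, 0 ≤ K₂ x := fun x => by positivity
  have b2 : ∀ x, |K₂ x| ≤ 2 * ε ^ 2 * (1 / ε ^ 2) ^ 2 := fun x => by
    rw [abs_of_nonneg (p2 x)]
    exact mul_le_mul_of_nonneg_left (sq_le_sq.2 ((abs_evenKernel_le hε x).trans (le_abs_self _)))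
      (by positivity)
  have hsum : (fun x => K₁ x + K₂ x) = evenKernel ε := by
    funext x
    have h : x ^ 2 + ε ^ 2 ≠ 0 := by positivity
    simp only [hK₁, hK₂, evenKernel]
    field_simp
    ring
  have e1 := differenceForm_add_kernel c1 b1 c2 b2 hF hF
  rw [hsum] at e1
  have e2 := differenceForm_self_nonneg c2 b2 (fun x => by simp only [hK₂, evenKernel_neg]) p2 hF
  have e3 := differenceForm_eq_sub c1 b1 hF hF
  have e4 := abs_integral_diag_le (B := 2 * B) c1 b1 hF hF hf hf (by positivity) (by
    intro x hx
    simp only [hK₁, hFdef]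
    rw [setIntegral_sq_sub_div hε, show u x * f x * (u x * f x) = u x ^ 2 * (f x * f x) by ring,
      abs_mul, mul_right_comm]
    refine mul_le_mul_of_nonneg_right ?_ (abs_nonneg _)
    rw [abs_of_nonneg (sq_nonneg (u x))]
    rcases lt_or_ge (π / 4) x with h | h
    · rw [hs x hx h]; simp only [ne_eq, OfNat.ofNat_ne_zero, not_false_eq_true, zero_pow, zero_mul]
      positivity
    · have hx0 : 0 < x := hx.1
      have hy : x ≤ π - x := by linarith [pi_pos]
      have q : ∀ y, x ≤ y → y / (y ^ 2 + ε ^ 2) ≤ 1 / x := by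
        intro y hy
        have : 0 < y := hx0.trans_le hy
        rw [div_le_div_iff₀ (by positivity) hx0]
        nlinarith [sq_nonneg ε]
      have q1 := q x le_rfl
      have q2 := q _ hy
      have q3 : 0 ≤ x / (x ^ 2 + ε ^ 2) := by positivity
      have q4 : 0 ≤ (π - x) / ((π - x) ^ 2 + ε ^ 2) := by
        have : 0 < π - x := hx0.trans_le hy
        positivity
      have q5 : (x - π) / ((x - π) ^ 2 + ε ^ 2) = -((π - x) / ((π - x) ^ 2 + ε ^ 2)) := by
        rw [← neg_div, neg_sub, show (x - π) ^ 2 = (π - x) ^ 2 by ring]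
      have q6 : |(x - π) / ((x - π) ^ 2 + ε ^ 2) - x / (x ^ 2 + ε ^ 2)| ≤ 2 / x := by
        rw [q5, abs_le, show 2 / x = 1 / x + 1 / x by ring]
        constructor <;> linarith
      calc u x ^ 2 * |(x - π) / ((x - π) ^ 2 + ε ^ 2) - x / (x ^ 2 + ε ^ 2)|
          ≤ (B * x) * (2 / x) := by gcongr; exact hu x hx
        _ = 2 * B := by field_simp)
  have e5 : ∫ z : ℝ × ℝ, (ε ^ 2 - (z.1 - z.2) ^ 2) / ((z.1 - z.2) ^ 2 + ε ^ 2) ^ 2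
        * (F z.1 * F z.2) ∂(arcMeasure.prod arcMeasure)
      = -∫ z : ℝ × ℝ, K₁ (z.1 - z.2) * (F z.1 * F z.2) ∂(arcMeasure.prod arcMeasure) := by
    rw [← integral_neg]
    refine integral_congr_ae (Filter.Eventually.of_forall fun z => ?_)
    simp only [hK₁]
    rw [← neg_mul, ← neg_div, neg_sub]
  rw [e5]
  have := neg_abs_le (∫ z : ℝ × ℝ, K₁ (z.1 - z.2) * (F z.1 * F z.2)
    ∂(arcMeasure.prod arcMeasure))
  have e6 := (abs_le.1 e4).1
  linarith

/-- The odd form is dominated by the energies: off the diagonal because `2 * oddKernel ε` and the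
kernel of `integral_conv_le_differenceForm` are the sine and cosine transforms of the same
weight. -/
lemma abs_differenceForm_oddKernel_le (hε : 0 < ε) (hB : 0 ≤ B)
    (hu : ∀ x ∈ Ioc 0 π, u x ^ 2 ≤ B * x) (hs : ∀ x ∈ Ioc 0 π, π / 4 < x → u x = 0)
    (hf : MemLp f 2 arcMeasure) (hg : MemLp g 2 arcMeasure)
    (hF : MemLp (fun x => u x * f x) 2 arcMeasure)
    (hG : MemLp (fun x => u x * g x) 2 arcMeasure) :
    |differenceForm arcMeasure (oddKernel ε) (fun x => u x * f x) (fun x => u x * g x)|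
      ≤ (differenceForm arcMeasure (evenKernel ε) (fun x => u x * f x) (fun x => u x * f x)
        + differenceForm arcMeasure (evenKernel ε) (fun x => u x * g x) (fun x => u x * g x)) / 2
        + B * ((∫ x, f x ^ 2 ∂arcMeasure) + ∫ x, g x ^ 2 ∂arcMeasure) := by
  have b0 : ∀ x, |oddKernel ε x| ≤ 1 / ε ^ 2 := fun x =>
    (abs_oddKernel_le_evenKernel hε x).trans ((le_abs_self _).trans (abs_evenKernel_le hε x))
  have c0 := continuous_oddKernel hε
  have e1 := differenceForm_eq_sub c0 b0 hF hG
  have e2 := abs_integral_diag_le (B := B) c0 b0 hF hG hf hg hB (by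
    intro x hx
    rw [setIntegral_oddKernel hε, show u x * f x * (u x * g x) = u x ^ 2 * (f x * g x) by ring,
      abs_mul, mul_right_comm]
    refine mul_le_mul_of_nonneg_right ?_ (abs_nonneg _)
    rw [abs_of_nonneg (sq_nonneg (u x))]
    rcases lt_or_ge (π / 4) x with h | h
    · rw [hs x hx h]; simpa using hB
    · have hx0 : 0 < x := hx.1
      have hy : x ^ 2 ≤ (x - π) ^ 2 := by nlinarith [pi_pos]
      have q1 : 0 ≤ ε / 2 / (x ^ 2 + ε ^ 2) := by positivity
      have q2 : 0 ≤ ε / 2 / ((x - π) ^ 2 + ε ^ 2) := by positivity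
      have q3 : ε / 2 / ((x - π) ^ 2 + ε ^ 2) ≤ ε / 2 / (x ^ 2 + ε ^ 2) := by gcongr
      have q4 : ε / 2 / (x ^ 2 + ε ^ 2) ≤ 1 / x := by
        rw [div_le_div_iff₀ (by positivity) hx0]
        nlinarith [sq_nonneg (x - ε), sq_nonneg x, sq_nonneg ε]
      calc u x ^ 2 * |ε / 2 / ((x - π) ^ 2 + ε ^ 2) - ε / 2 / (x ^ 2 + ε ^ 2)|
          ≤ (B * x) * (1 / x) := by
            gcongr
            · exact hu x hx
            · rw [abs_le]; constructor <;> linarith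
        _ = B := by field_simp)
  have e3 := abs_integral_sin_kernel_le (μ := arcMeasure) (w := fun ξ => ξ * exp (-ε * ξ))
    (c := fun x => (ε ^ 2 - x ^ 2) / (x ^ 2 + ε ^ 2) ^ 2) (s := fun x => 2 * oddKernel ε x)
    (Cc := 1 / ε ^ 2) (Cs := 2 * (1 / ε ^ 2)) (fun ξ hξ => mul_nonneg (le_of_lt hξ) (exp_pos _).le)
    (integrableOn_mul_exp_weight hε) (fun x => (integral_mul_exp_weight hε x).1)
    (fun x => (integral_mul_exp_weight hε x).2)
    (Continuous.div (by fun_prop) (by fun_prop) fun x => by positivity)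
    (c0.const_mul 2)
    (fun x => by rw [← neg_sub, neg_div, abs_neg]; exact abs_sq_sub_div_le hε x)
    (fun x => by rw [abs_mul, abs_two]; gcongr; exact b0 x) hF hG
  have e4 := integral_conv_le_differenceForm hε hB hu hs hf hF
  have e5 := integral_conv_le_differenceForm hε hB hu hs hg hG
  simp only [mul_assoc (2 : ℝ)] at e3
  rw [integral_const_mul, abs_mul, abs_two] at e3
  have p1 := differenceForm_self_nonneg (continuous_evenKernel hε) (abs_evenKernel_le hε)
    (evenKernel_neg ε) (evenKernel_nonneg ε) hF
  have p2 := differenceForm_self_nonneg (continuous_evenKernel hε) (abs_evenKernel_le hε)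
    (evenKernel_neg ε) (evenKernel_nonneg ε) hG
  rw [e1]
  refine (abs_sub _ _).trans ?_
  linarith

end ArcForms

/-! ### Coefficients with a first-order Taylor expansion -/

/-- A coefficient `p` on `[0, π]` with derivative `p'`: quadratic Taylor remainder and derivative
bounded by `B`, linear vanishing at `0`, support in `[0, π/4]`. Unlike `IsCoeff` this is visibly
stable under linear combinations. -/
structure HasTaylorBound (B : ℝ) (p p' : ℝ → ℝ) : Prop where
  continuousOn : ContinuousOn p (Icc 0 π)
  continuousOn_deriv : ContinuousOn p' (Icc 0 π)
  taylor : ∀ x ∈ Icc 0 π, ∀ y ∈ Icc 0 π, |p y - p x - p' x * (y - x)| ≤ B * (y - x) ^ 2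
  deriv_le : ∀ x ∈ Icc 0 π, |p' x| ≤ B
  linear : ∀ x ∈ Icc 0 π, |p x| ≤ B * x
  support : ∀ x ∈ Icc 0 π, π / 4 < x → p x = 0

lemma IsCoeff.nonneg {A : ℝ} {c : ℝ → ℝ} (h : IsCoeff A c) : 0 ≤ A :=
  (abs_nonneg _).trans (h.deriv_bound 0 (by norm_num) 0 ⟨le_rfl, pi_pos.le⟩)

lemma IsCoeff.hasTaylorBound {A : ℝ} {c : ℝ → ℝ} (h : IsCoeff A c) :
    HasTaylorBound A c (derivWithin c (Icc 0 π)) := by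
  have hU : UniqueDiffOn ℝ (Icc (0 : ℝ) π) := uniqueDiffOn_Icc pi_pos
  have hd : DifferentiableOn ℝ c (Icc 0 π) := h.contDiffOn.differentiableOn (by norm_num)
  have hc' : ContDiffOn ℝ 1 (derivWithin c (Icc 0 π)) (Icc 0 π) :=
    h.contDiffOn.derivWithin hU (by norm_num)
  have b1 : ∀ x ∈ Icc (0 : ℝ) π, |derivWithin c (Icc 0 π) x| ≤ A := fun x hx => by
    rw [← iteratedDerivWithin_one]; exact h.deriv_bound 1 (by norm_num) x hx
  have e2 : ∀ x ∈ Icc (0 : ℝ) π,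
      ‖derivWithin (derivWithin c (Icc 0 π)) (Icc 0 π) x‖ ≤ A := fun x hx => by
    have := h.deriv_bound 2 le_rfl x hx
    rw [iteratedDerivWithin_succ] at this
    rwa [iteratedDerivWithin_one] at this
  have hlip : ∀ x ∈ Icc (0 : ℝ) π, ∀ y ∈ Icc (0 : ℝ) π,
      ‖derivWithin c (Icc 0 π) y - derivWithin c (Icc 0 π) x‖ ≤ A * ‖y - x‖ := fun x hx y hy =>
    (convex_Icc 0 π).norm_image_sub_le_of_norm_derivWithin_le
      (hc'.differentiableOn (by norm_num)) e2 hx hy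
  refine ⟨hd.continuousOn, hc'.continuousOn, fun x hx y hy => ?_, b1, h.linear_bound,
    fun x hx hx4 => ?_⟩
  · have hsub : uIcc x y ⊆ Icc 0 π := by
      rw [← uIcc_of_le pi_pos.le]
      exact uIcc_subset_uIcc (by rwa [uIcc_of_le pi_pos.le]) (by rwa [uIcc_of_le pi_pos.le])
    have hder : ∀ t ∈ uIcc x y, HasDerivWithinAt
        (fun t => c t - derivWithin c (Icc 0 π) x * t)
        (derivWithin c (Icc 0 π) t - derivWithin c (Icc 0 π) x) (uIcc x y) t := by
      intro t ht
      have d1 := ((hd t (hsub ht)).hasDerivWithinAt).mono hsub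
      have d2 := ((hasDerivWithinAt_id t (uIcc x y)).const_mul (derivWithin c (Icc 0 π) x))
      rw [mul_one] at d2
      exact d1.sub d2
    have hb : ∀ t ∈ uIcc x y, ‖derivWithin c (Icc 0 π) t - derivWithin c (Icc 0 π) x‖
        ≤ A * |y - x| := by
      intro t ht
      refine (hlip x hx t (hsub ht)).trans ?_
      exact mul_le_mul_of_nonneg_left (abs_sub_left_of_mem_uIcc ht) h.nonneg
    have := (convex_uIcc x y).norm_image_sub_le_of_norm_hasDerivWithin_le hder hb
      left_mem_uIcc right_mem_uIcc
    rw [Real.norm_eq_abs, Real.norm_eq_abs, mul_assoc, abs_mul_abs_self] at this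
    calc _ = _ := by congr 1; ring
      _ ≤ _ := this
      _ = _ := by ring
  · by_contra hne
    exact absurd (h.support_subset x hx hne).2 (not_le.2 hx4)

namespace HasTaylorBound

variable {B : ℝ} {p p' : ℝ → ℝ}

lemma combine {A a b : ℝ} {c c' d d' : ℝ → ℝ} (hc : HasTaylorBound A c c')
    (hd : HasTaylorBound A d d') (hAB : (|a| + |b|) * A ≤ B) :
    HasTaylorBound B (fun x => a * c x + b * d x) (fun x => a * c' x + b * d' x) := by
  have key : ∀ {s t r : ℝ}, 0 ≤ r → |s| ≤ A * r → |t| ≤ A * r → |a * s + b * t| ≤ B * r := by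
    intro s t r hr hs ht
    calc |a * s + b * t| ≤ |a| * |s| + |b| * |t| := by
          rw [← abs_mul, ← abs_mul]; exact abs_add_le _ _
      _ ≤ |a| * (A * r) + |b| * (A * r) := by gcongr
      _ = (|a| + |b|) * A * r := by ring
      _ ≤ B * r := by gcongr
  refine ⟨(hc.continuousOn.const_smul a).add (hd.continuousOn.const_smul b),
    (hc.continuousOn_deriv.const_smul a).add (hd.continuousOn_deriv.const_smul b),
    fun x hx y hy => ?_, fun x hx => ?_, fun x hx => ?_, fun x hx h4 => ?_⟩
  · rw [show a * c y + b * d y - (a * c x + b * d x) - (a * c' x + b * d' x) * (y - x)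
      = a * (c y - c x - c' x * (y - x)) + b * (d y - d x - d' x * (y - x)) by ring]
    exact key (sq_nonneg _) (hc.taylor x hx y hy) (hd.taylor x hx y hy)
  · simpa using key zero_le_one (by simpa using hc.deriv_le x hx) (by simpa using hd.deriv_le x hx)
  · exact key hx.1 (hc.linear x hx) (hd.linear x hx)
  · rw [hc.support x hx h4, hd.support x hx h4]; ring

lemma abs_sub_le (hp : HasTaylorBound B p p') {x y : ℝ} (hx : x ∈ Icc 0 π) (hy : y ∈ Icc 0 π) :
    |p x - p y| ≤ 5 * B * |x - y| := by
  have h1 := hp.taylor x hx y hy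
  have h2 := hp.deriv_le x hx
  have hB : 0 ≤ B := (abs_nonneg _).trans h2
  have h3 : |x - y| ≤ 4 := by
    rw [abs_le]; constructor <;> linarith [hx.1, hx.2, hy.1, hy.2, pi_le_four]
  have h4 : |p x - p y| ≤ |p y - p x - p' x * (y - x)| + |p' x * (y - x)| := by
    rw [abs_sub_comm (p x)]
    calc |p y - p x| = |(p y - p x - p' x * (y - x)) + p' x * (y - x)| := by congr 1; ring
      _ ≤ _ := abs_add_le _ _
  rw [abs_mul, abs_sub_comm y x] at h4
  have h5 : |p' x| * |x - y| ≤ B * |x - y| := by gcongr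
  have h6 : B * (y - x) ^ 2 ≤ B * (4 * |x - y|) := by
    rw [show (y - x) ^ 2 = |x - y| * |x - y| by rw [abs_mul_abs_self]; ring]
    gcongr
  linarith

/-- A nonnegative coefficient satisfies `x p'(x)² ≤ 4 B p(x)`: the tangent line at `x` cannot go
below zero faster than the quadratic remainder allows. The factor `x` reflects that there is room
only of length `x` to the left of `x`. -/
lemma deriv_sq_mul_le (hp : HasTaylorBound B p p') (hB : 0 < B) (h0 : ∀ x ∈ Icc 0 π, 0 ≤ p x)
    {x : ℝ} (hx : x ∈ Ioc 0 π) : p' x ^ 2 * x ≤ 4 * B * p x := by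
  have hxI : x ∈ Icc 0 π := ⟨hx.1.le, hx.2⟩
  rcases lt_or_ge (π / 4) x with h4 | h4
  · -- to the left of `x` the coefficient still vanishes, hence so does the derivative at `x`
    have hz : p' x = 0 := by
      by_contra hne
      have hpos : 0 < |p' x| := abs_pos.2 hne
      have hδ : 0 < min ((x - π / 4) / 2) (|p' x| / (2 * B)) :=
        lt_min (by linarith) (by positivity)
      set δ := min ((x - π / 4) / 2) (|p' x| / (2 * B)) with hδd
      have d1 : δ ≤ (x - π / 4) / 2 := min_le_left _ _
      have d2 : δ ≤ |p' x| / (2 * B) := min_le_right _ _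
      have hy : x - δ ∈ Icc 0 π := ⟨by linarith [pi_pos], by linarith [hx.2]⟩
      have ht := hp.taylor x hxI _ hy
      rw [hp.support x hxI h4, hp.support _ hy (by linarith)] at ht
      rw [show (0 : ℝ) - 0 - p' x * (x - δ - x) = p' x * δ by ring,
        show (x - δ - x) ^ 2 = δ * δ by ring, abs_mul, abs_of_pos hδ, ← mul_assoc] at ht
      have ht' := le_of_mul_le_mul_right ht hδ
      rw [le_div_iff₀ (by positivity)] at d2
      nlinarith
    rw [hz, hp.support x hxI h4]; simp
  · set m := p' x with hm
    have hmB := hp.deriv_le x hxI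
    have hx1 : x ≤ 1 := by linarith [pi_le_four]
    -- the minimizer `x - m / (2 * B)` of the Taylor bound may lie outside `[0, π]`; as `|m| ≤ B`,
    -- scaling the step by `x ≤ 1` keeps the point inside
    set y := x - m * x / (2 * B) with hy
    have hr : |m * x / (2 * B)| ≤ x := by
      rw [abs_div, abs_mul, abs_of_pos hx.1, abs_of_pos (by positivity : 0 < 2 * B),
        div_le_iff₀ (by positivity)]
      nlinarith [hx.1]
    rw [abs_le] at hr
    have hyI : y ∈ Icc 0 π := ⟨by linarith, by linarith [pi_pos]⟩
    have ht := (abs_le.1 (hp.taylor x hxI y hyI)).2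
    have hpy := h0 y hyI
    rw [show y - x = -(m * x / (2 * B)) by rw [hy]; ring] at ht
    have e : m * -(m * x / (2 * B)) + B * (-(m * x / (2 * B))) ^ 2
        = (-(2 * (m ^ 2 * x)) + m ^ 2 * x * x) / (4 * B) := by field_simp; ring
    have h1 : 0 ≤ p x + (-(2 * (m ^ 2 * x)) + m ^ 2 * x * x) / (4 * B) := by
      rw [← e]; linarith
    have h2 : m ^ 2 * x * x ≤ m ^ 2 * x := by
      have : 0 ≤ m ^ 2 * x := mul_nonneg (sq_nonneg _) hx.1.le
      nlinarith
    rw [← neg_le_iff_add_nonneg, ← neg_div, div_le_iff₀ (by positivity)] at h1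
    linarith

/-- The square root of a nonnegative coefficient is Lipschitz as a function of `√x`, stated in
the form in which it cancels the singularity of the kernels. -/
lemma sqrt_sub_sq_mul_le (hp : HasTaylorBound B p p') (hB : 0 < B) (h0 : ∀ x ∈ Icc 0 π, 0 ≤ p x)
    {x y : ℝ} (hx : x ∈ Ioc 0 π) (hy : y ∈ Ioc 0 π) :
    (√(p x) - √(p y)) ^ 2 * (x + y) ≤ 56 * B * (x - y) ^ 2 := by
  wlog hxy : y ≤ x generalizing x y
  · have := this hy hx (le_of_not_ge hxy)
    linarith [this, show (√(p y) - √(p x)) ^ 2 * (y + x) = (√(p x) - √(p y)) ^ 2 * (x + y) by ring,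
      show 56 * B * (y - x) ^ 2 = 56 * B * (x - y) ^ 2 by ring]
  have hxI : x ∈ Icc 0 π := ⟨hx.1.le, hx.2⟩
  have hyI : y ∈ Icc 0 π := ⟨hy.1.le, hy.2⟩
  have hd := hp.deriv_sq_mul_le hB h0 hx
  have ht := hp.taylor x hxI y hyI
  have hP := h0 x hxI
  have hQ := h0 y hyI
  have hx0 : 0 < x := hx.1
  have hx4 : x ≤ 4 := hx.2.trans pi_le_four
  have hx2 : x ^ 2 ≤ 10 := by nlinarith [hx.2, pi_lt_d2, pi_pos]
  set m := p' x
  set P := p x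
  set Q := p y
  set t := x - y with htd
  have ht0 : 0 ≤ t := by linarith
  have hty : y - x = -t := by ring
  rw [hty] at ht
  have hdiff : |Q - P| ≤ |m| * t + B * t ^ 2 := by
    calc |Q - P| = |(Q - P - m * -t) + m * -t| := by congr 1; ring
      _ ≤ |Q - P - m * -t| + |m * -t| := abs_add_le _ _
      _ ≤ B * (-t) ^ 2 + |m| * t := by
        rw [abs_mul, abs_neg, abs_of_nonneg ht0]; gcongr
      _ = _ := by ring
  have hm2 : |m| ^ 2 * x ≤ 4 * B * P := by rwa [sq_abs]
  have hsq : (√P - √Q) ^ 2 * (√P + √Q) ^ 2 = (Q - P) ^ 2 := by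
    rw [← mul_pow, show (√P - √Q) * (√P + √Q) = √P ^ 2 - √Q ^ 2 by ring, sq_sqrt hP, sq_sqrt hQ]
    ring
  have hsP := sqrt_nonneg P
  have hsQ := sqrt_nonneg Q
  suffices h : (√P - √Q) ^ 2 * x ≤ 28 * B * t ^ 2 by
    nlinarith [sq_nonneg (√P - √Q)]
  rcases le_or_gt (B * t ^ 2) (P * x) with hc | hc
  · rcases ht0.eq_or_lt with h | h
    · have hxy' : y = x := by linarith
      have hPQ : P = Q := by simp only [P, Q, hxy']
      rw [hPQ, sub_self]; simp; positivity
    · have hPpos : 0 < P := by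
        have : 0 < P * x := lt_of_lt_of_le (by positivity) hc
        exact pos_of_mul_pos_left this hx0.le
      have g1 : (√P - √Q) ^ 2 * P ≤ (Q - P) ^ 2 := by
        rw [← hsq]
        refine mul_le_mul_of_nonneg_left ?_ (sq_nonneg _)
        nlinarith [sq_sqrt hP]
      have g2 : (Q - P) ^ 2 ≤ 2 * (|m| ^ 2 * t ^ 2) + 2 * (B * t ^ 2) ^ 2 := by
        rw [← sq_abs (Q - P)]
        have := pow_le_pow_left₀ (abs_nonneg _) hdiff 2
        nlinarith [sq_nonneg (|m| * t - B * t ^ 2)]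
      have g3 : |m| ^ 2 * t ^ 2 * x ≤ 4 * B * P * t ^ 2 := by nlinarith [sq_nonneg t]
      have g4 : (B * t ^ 2) ^ 2 * x ≤ 10 * B * P * t ^ 2 := by
        calc (B * t ^ 2) ^ 2 * x = (B * t ^ 2) * (B * t ^ 2) * x := by ring
          _ ≤ (B * t ^ 2) * (P * x) * x := by gcongr
          _ = (B * P * t ^ 2) * x ^ 2 := by ring
          _ ≤ (B * P * t ^ 2) * 10 := by gcongr
          _ = _ := by ring
      have g5 : P * ((√P - √Q) ^ 2 * x) ≤ P * (28 * B * t ^ 2) := by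
        have := mul_le_mul_of_nonneg_right (g1.trans g2) hx0.le
        linarith
      exact le_of_mul_le_mul_left g5 hPpos
  · have g1 : |m| * x ≤ 2 * B * t := by
      refine abs_le_of_sq_le_sq' ?_ (by positivity) |>.2
      have : |m| ^ 2 * x * x ≤ 4 * B * P * x := by gcongr
      nlinarith
    have g2 : (√P - √Q) ^ 2 ≤ |Q - P| := by
      have e : |Q - P| = |√P - √Q| * (√P + √Q) := by
        rw [← abs_of_nonneg (add_nonneg hsP hsQ), ← abs_mul,
          show (√P - √Q) * (√P + √Q) = √P ^ 2 - √Q ^ 2 by ring, sq_sqrt hP, sq_sqrt hQ,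
          abs_sub_comm]
      rw [e, ← sq_abs, sq]
      refine mul_le_mul_of_nonneg_left ?_ (abs_nonneg _)
      rw [abs_le]; constructor <;> linarith
    calc (√P - √Q) ^ 2 * x ≤ (|m| * t + B * t ^ 2) * x := by gcongr; exact g2.trans hdiff
      _ = (|m| * x) * t + B * t ^ 2 * x := by ring
      _ ≤ (2 * B * t) * t + B * t ^ 2 * 4 := by gcongr
      _ ≤ 28 * B * t ^ 2 := by nlinarith [mul_nonneg hB.le (sq_nonneg t)]

end HasTaylorBound

/-! ### Commutator terms -/

section Commutators

variable {K p p' u f g : ℝ → ℝ} {k : ℝ × ℝ → ℝ} {B C ε : ℝ}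

/-- Schur's test against a multiple of the Poisson kernel. -/
lemma abs_integral_le_of_poissonKernel (hε : 0 < ε) (hC : 0 ≤ C)
    (hk : ∀ x ∈ Ioc 0 π, ∀ y ∈ Ioc 0 π, |k (x, y)| ≤ C * (ε / ((x - y) ^ 2 + ε ^ 2)))
    (hf : MemLp f 2 arcMeasure) (hg : MemLp g 2 arcMeasure) :
    |∫ z : ℝ × ℝ, k z * (f z.1 * g z.2) ∂(arcMeasure.prod arcMeasure)|
      ≤ C * π / 2 * ((∫ x, f x ^ 2 ∂arcMeasure) + ∫ x, g x ^ 2 ∂arcMeasure) := by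
  have hm : Measurable fun z : ℝ × ℝ => C * (ε / ((z.1 - z.2) ^ 2 + ε ^ 2)) := by fun_prop
  have h0 : ∀ z : ℝ × ℝ, 0 ≤ C * (ε / ((z.1 - z.2) ^ 2 + ε ^ 2)) := fun z => by positivity
  have hl : ∀ x : ℝ, ∫⁻ y, ENNReal.ofReal (C * (ε / ((x - y) ^ 2 + ε ^ 2))) ∂arcMeasure
      ≤ ENNReal.ofReal (C * π) := fun x => by
    simp_rw [ENNReal.ofReal_mul hC]
    rw [lintegral_const_mul' _ _ ENNReal.ofReal_ne_top]
    gcongr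
    exact lintegral_poissonKernel_le hε x
  refine abs_integral_kernel_le_of_schur hm hm (Filter.Eventually.of_forall h0)
    (Filter.Eventually.of_forall h0) (ae_prod_arcMeasure fun x hx y hy => ?_)
    (by positivity) (Filter.Eventually.of_forall hl) (Filter.Eventually.of_forall fun y => ?_) hf hg
  · rw [← sq_abs, sq]
    exact mul_self_le_mul_self (abs_nonneg _) (hk x hx y hy)
  · refine le_trans (le_of_eq ?_) (hl y)
    refine lintegral_congr fun x => ?_
    rw [show (x - y) ^ 2 = (y - x) ^ 2 by ring]

/-- Schur's test against a multiple of Hilbert's kernel `1 / (x + y)`. -/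
lemma abs_integral_le_of_hilbertKernel (hC : 0 ≤ C)
    (hk : ∀ x ∈ Ioc 0 π, ∀ y ∈ Ioc 0 π, |k (x, y)| * (x + y) ≤ C)
    (hf : MemLp f 2 arcMeasure) (hg : MemLp g 2 arcMeasure) :
    |∫ z : ℝ × ℝ, k z * (f z.1 * g z.2) ∂(arcMeasure.prod arcMeasure)|
      ≤ C * π / 2 * ((∫ x, f x ^ 2 ∂arcMeasure) + ∫ x, g x ^ 2 ∂arcMeasure) := by
  have hl : ∀ᵐ x ∂arcMeasure, ∫⁻ y, ENNReal.ofReal (C * (√x / (√y * (x + y)))) ∂arcMeasure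
      ≤ ENNReal.ofReal (C * π) := by
    refine (ae_restrict_iff' measurableSet_Ioc).2 (Filter.Eventually.of_forall fun x hx => ?_)
    simp_rw [ENNReal.ofReal_mul hC]
    rw [lintegral_const_mul' _ _ ENNReal.ofReal_ne_top]
    gcongr
    exact lintegral_hilbertKernel_le hx.1
  refine abs_integral_kernel_le_of_schur
    (a := fun z => C * (√z.1 / (√z.2 * (z.1 + z.2))))
    (b := fun z => C * (√z.2 / (√z.1 * (z.2 + z.1)))) (by fun_prop) (by fun_prop)
    (ae_prod_arcMeasure fun x hx y hy => ?_) (ae_prod_arcMeasure fun x hx y hy => ?_)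
    (ae_prod_arcMeasure fun x hx y hy => ?_) (by positivity) hl hl hf hg
  · have := hx.1; have := hy.1; positivity
  · have := hx.1; have := hy.1; positivity
  · have hx0 := hx.1
    have hy0 := hy.1
    have hsx : 0 < √x := sqrt_pos.2 hx0
    have hsy : 0 < √y := sqrt_pos.2 hy0
    have h := hk x hx y hy
    rw [← le_div_iff₀ (by positivity)] at h
    calc k (x, y) ^ 2 = |k (x, y)| ^ 2 := (sq_abs _).symm
      _ ≤ (C / (x + y)) ^ 2 := by gcongr
      _ = _ := by
        dsimp only
        field_simp
        ring

/-- The second-order commutator with `√p` is bounded by Hilbert's inequality. -/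
lemma abs_integral_sqrt_commutator_le (hε : 0 < ε) (hp : HasTaylorBound B p p') (hB : 0 < B)
    (h0 : ∀ x ∈ Icc 0 π, 0 ≤ p x) (hK : ∀ x, |K x| ≤ evenKernel ε x)
    (hf : MemLp f 2 arcMeasure) (hg : MemLp g 2 arcMeasure) :
    |∫ z : ℝ × ℝ, (K (z.1 - z.2) * (√(p z.1) - √(p z.2)) ^ 2) * (f z.1 * g z.2)
      ∂(arcMeasure.prod arcMeasure)|
      ≤ 28 * B * π * ((∫ x, f x ^ 2 ∂arcMeasure) + ∫ x, g x ^ 2 ∂arcMeasure) := by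
  refine (abs_integral_le_of_hilbertKernel (C := 56 * B) (by positivity)
    (k := fun z => K (z.1 - z.2) * (√(p z.1) - √(p z.2)) ^ 2) (fun x hx y hy => ?_)
    hf hg).trans (le_of_eq (by ring))
  have h := hp.sqrt_sub_sq_mul_le hB h0 hx hy
  rw [abs_mul, abs_of_nonneg (sq_nonneg (√(p x) - √(p y))), mul_assoc]
  have hxy : 0 ≤ (√(p x) - √(p y)) ^ 2 * (x + y) :=
    mul_nonneg (sq_nonneg _) (add_nonneg hx.1.le hy.1.le)
  calc |K (x - y)| * ((√(p x) - √(p y)) ^ 2 * (x + y))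
      ≤ evenKernel ε (x - y) * (56 * B * (x - y) ^ 2) :=
        mul_le_mul (hK _) h hxy (evenKernel_nonneg _ _)
    _ = 56 * B * (evenKernel ε (x - y) * (x - y) ^ 2) := by ring
    _ ≤ 56 * B * 1 := by gcongr; exact evenKernel_mul_sq_le hε _
    _ = 56 * B := mul_one _

lemma abs_integral_odd_commutator_le (hε : 0 < ε) (hp : HasTaylorBound B p p') (hB : 0 < B)
    (hf : MemLp f 2 arcMeasure) (hg : MemLp g 2 arcMeasure) :
    |∫ z : ℝ × ℝ, (oddKernel ε (z.1 - z.2) * (p z.1 - p z.2)) * (f z.1 * g z.2)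
      ∂(arcMeasure.prod arcMeasure)|
      ≤ 5 * B * π / 2 * ((∫ x, f x ^ 2 ∂arcMeasure) + ∫ x, g x ^ 2 ∂arcMeasure) := by
  refine abs_integral_le_of_poissonKernel (C := 5 * B) hε (by positivity)
    (k := fun z => oddKernel ε (z.1 - z.2) * (p z.1 - p z.2)) (fun x hx y hy => ?_) hf hg
  have h := hp.abs_sub_le (Ioc_subset_Icc_self hx) (Ioc_subset_Icc_self hy)
  have h2 := abs_oddKernel_mul_abs_le hε (x - y)
  rw [abs_mul]
  calc |oddKernel ε (x - y)| * |p x - p y| ≤ |oddKernel ε (x - y)| * (5 * B * |x - y|) := by gcongr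
    _ = 5 * B * (|oddKernel ε (x - y)| * |x - y|) := by ring
    _ ≤ _ := by gcongr

lemma HasTaylorBound.aestronglyMeasurable (hp : HasTaylorBound B p p') :
    AEStronglyMeasurable p arcMeasure :=
  (hp.continuousOn.mono Ioc_subset_Icc_self).aestronglyMeasurable measurableSet_Ioc

lemma HasTaylorBound.aestronglyMeasurable_deriv (hp : HasTaylorBound B p p') :
    AEStronglyMeasurable p' arcMeasure :=
  (hp.continuousOn_deriv.mono Ioc_subset_Icc_self).aestronglyMeasurable measurableSet_Ioc

lemma memLp_mul_of_bound (hu : AEStronglyMeasurable u arcMeasure)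
    (hb : ∀ x ∈ Ioc 0 π, |u x| ≤ B) (hf : MemLp f 2 arcMeasure) :
    MemLp (fun x => u x * f x) 2 arcMeasure := by
  refine hf.of_le_mul (c := B) (hu.mul hf.1) ?_
  refine (ae_restrict_iff' measurableSet_Ioc).2 (Filter.Eventually.of_forall fun x hx => ?_)
  rw [norm_mul]
  exact mul_le_mul_of_nonneg_right (hb x hx) (norm_nonneg _)

lemma abs_div_sq_add_sq_le (hε : 0 < ε) (x : ℝ) : |x / (x ^ 2 + ε ^ 2)| ≤ 1 / ε := by
  have h : 0 < x ^ 2 + ε ^ 2 := by positivity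
  rw [abs_div, abs_of_pos h, div_le_div_iff₀ h hε]
  nlinarith [sq_nonneg (|x| - ε), sq_abs x, abs_nonneg x]

/-- The even commutator: its leading part is the smoothed Hilbert transform of `p' f`, bounded
because its kernel and the Poisson kernel are the sine and cosine transforms of `e^{-εξ}`; the
Taylor remainder gives a bounded kernel. -/
lemma abs_integral_even_commutator_le (hε : 0 < ε) (hp : HasTaylorBound B p p') (hB : 0 < B)
    (hf : MemLp f 2 arcMeasure) (hg : MemLp g 2 arcMeasure) :
    |∫ z : ℝ × ℝ, (evenKernel ε (z.1 - z.2) * (p z.1 - p z.2)) * (f z.1 * g z.2)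
      ∂(arcMeasure.prod arcMeasure)|
      ≤ π * (B ^ 2 + 1 + B) * ((∫ x, f x ^ 2 ∂arcMeasure) + ∫ x, g x ^ 2 ∂arcMeasure) := by
  set H : ℝ → ℝ := fun x => x / (x ^ 2 + ε ^ 2) with hH
  have cH : Continuous H := Continuous.div (by fun_prop) (by fun_prop) fun x => by positivity
  have hp'f : MemLp (fun x => p' x * f x) 2 arcMeasure :=
    memLp_mul_of_bound hp.aestronglyMeasurable_deriv
      (fun x hx => hp.deriv_le x (Ioc_subset_Icc_self hx)) hf
  set r : ℝ × ℝ → ℝ := fun z =>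
    evenKernel ε (z.1 - z.2) * (p z.1 - p z.2 - p' z.1 * (z.1 - z.2)) with hr
  have hrb : ∀ x ∈ Ioc 0 π, ∀ y ∈ Ioc 0 π, |r (x, y)| ≤ B := by
    intro x hx y hy
    have h := hp.taylor x (Ioc_subset_Icc_self hx) y (Ioc_subset_Icc_self hy)
    rw [abs_mul, abs_of_nonneg (evenKernel_nonneg _ _),
      show p x - p y - p' x * (x - y) = -(p y - p x - p' x * (y - x)) by ring, abs_neg]
    calc evenKernel ε (x - y) * |p y - p x - p' x * (y - x)|
        ≤ evenKernel ε (x - y) * (B * (y - x) ^ 2) :=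
          mul_le_mul_of_nonneg_left h (evenKernel_nonneg _ _)
      _ = B * (evenKernel ε (x - y) * (x - y) ^ 2) := by ring
      _ ≤ B * 1 := by gcongr; exact evenKernel_mul_sq_le hε _
      _ = B := mul_one _
  have hrm : AEStronglyMeasurable r (arcMeasure.prod arcMeasure) := by
    have c := continuous_evenKernel hε
    have m1 := hp.aestronglyMeasurable.comp_fst (ν := arcMeasure)
    have m2 := hp.aestronglyMeasurable.comp_snd (μ := arcMeasure)
    have m3 := hp.aestronglyMeasurable_deriv.comp_fst (ν := arcMeasure)
    have m4 : AEStronglyMeasurable (fun z : ℝ × ℝ => z.1 - z.2) (arcMeasure.prod arcMeasure) := by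
      fun_prop
    have m5 : AEStronglyMeasurable (fun z : ℝ × ℝ => evenKernel ε (z.1 - z.2))
      (arcMeasure.prod arcMeasure) := by fun_prop
    exact m5.mul ((m1.sub m2).sub (m3.mul m4))
  have i1 := integrable_conv_mul_prod cH (abs_div_sq_add_sq_le hε) hp'f hg
  have i2 := integrable_kernel_mul_prod hrm (ae_prod_arcMeasure hrb) hf hg
  have e : ∫ z : ℝ × ℝ, (evenKernel ε (z.1 - z.2) * (p z.1 - p z.2)) * (f z.1 * g z.2)
      ∂(arcMeasure.prod arcMeasure)
      = (∫ z : ℝ × ℝ, H (z.1 - z.2) * ((p' z.1 * f z.1) * g z.2) ∂(arcMeasure.prod arcMeasure))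
        + ∫ z : ℝ × ℝ, r z * (f z.1 * g z.2) ∂(arcMeasure.prod arcMeasure) := by
    rw [← integral_add i1 i2]
    refine integral_congr_ae (Filter.Eventually.of_forall fun z => ?_)
    simp only [hH, hr, evenKernel]
    ring
  have hN1 : 0 ≤ ∫ x, f x ^ 2 ∂arcMeasure := integral_nonneg fun x => sq_nonneg _
  have hN2 : 0 ≤ ∫ x, g x ^ 2 ∂arcMeasure := integral_nonneg fun x => sq_nonneg _
  have b1 := abs_integral_sin_kernel_le (μ := arcMeasure) (w := fun ξ => exp (-ε * ξ))
    (c := fun x => ε / (x ^ 2 + ε ^ 2)) (s := H) (Cc := 1 / ε) (Cs := 1 / ε)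
    (fun ξ _ => (exp_pos _).le) (integrableOn_exp_weight hε)
    (fun x => (integral_exp_weight hε x).1) (fun x => (integral_exp_weight hε x).2)
    (continuous_poissonKernel hε) cH
    (fun x => by
      rw [abs_of_nonneg (by positivity), div_le_div_iff₀ (by positivity) hε]
      nlinarith [sq_nonneg x])
    (abs_div_sq_add_sq_le hε) hp'f hg
  have hP : ∀ x ∈ Ioc 0 π, ∀ y ∈ Ioc 0 π,
      |ε / ((x - y) ^ 2 + ε ^ 2)| ≤ 1 * (ε / ((x - y) ^ 2 + ε ^ 2)) := fun x _ y _ => by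
    rw [one_mul, abs_of_nonneg (by positivity)]
  have b2 := (le_abs_self _).trans (abs_integral_le_of_poissonKernel
    (k := fun z => ε / ((z.1 - z.2) ^ 2 + ε ^ 2)) hε zero_le_one hP hp'f hp'f)
  have b3 := (le_abs_self _).trans (abs_integral_le_of_poissonKernel
    (k := fun z => ε / ((z.1 - z.2) ^ 2 + ε ^ 2)) hε zero_le_one hP hg hg)
  have b4 : ∫ x, (p' x * f x) ^ 2 ∂arcMeasure ≤ B ^ 2 * ∫ x, f x ^ 2 ∂arcMeasure := by
    rw [← integral_const_mul]
    refine integral_mono_ae hp'f.integrable_sq (hf.integrable_sq.const_mul _) ?_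
    refine (ae_restrict_iff' measurableSet_Ioc).2 (Filter.Eventually.of_forall fun x hx => ?_)
    dsimp only
    rw [mul_pow]
    refine mul_le_mul_of_nonneg_right ?_ (sq_nonneg _)
    rw [← sq_abs]
    exact pow_le_pow_left₀ (abs_nonneg _) (hp.deriv_le x (Ioc_subset_Icc_self hx)) 2
  have hlB : ∀ x : ℝ, ∫⁻ _ : ℝ, ENNReal.ofReal B ∂arcMeasure ≤ ENNReal.ofReal (B * π) := fun x => by
    rw [lintegral_const, Measure.restrict_apply_univ, Real.volume_Ioc, sub_zero,
      ENNReal.ofReal_mul hB.le]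
  have b5 := abs_integral_kernel_le_of_schur (k := r) (a := fun _ => B) (b := fun _ => B)
    measurable_const measurable_const (Filter.Eventually.of_forall fun _ => hB.le)
    (Filter.Eventually.of_forall fun _ => hB.le)
    (ae_prod_arcMeasure fun x hx y hy => by
      rw [← sq_abs, sq]; exact mul_self_le_mul_self (abs_nonneg _) (hrb x hx y hy))
    (by positivity : 0 ≤ B * π) (Filter.Eventually.of_forall hlB)
    (Filter.Eventually.of_forall hlB) hf hg
  rw [e]
  refine (abs_add_le _ _).trans ?_
  have hπ := pi_pos
  have b6 := mul_le_mul_of_nonneg_left b4 hπ.le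
  set X := ∫ x, f x ^ 2 ∂arcMeasure
  set Y := ∫ x, g x ^ 2 ∂arcMeasure
  have k1 : 0 ≤ π * B ^ 2 * X := by positivity
  have k2 : 0 ≤ π * B ^ 2 * Y := by positivity
  have k3 : 0 ≤ π * B * X := by positivity
  have k4 : 0 ≤ π * B * Y := by positivity
  have k5 : 0 ≤ π * X := by positivity
  have k6 : 0 ≤ π * Y := by positivity
  linarith

end Commutators

/-! ### The estimate for a nonnegative coefficient -/

section NonnegCoefficient

variable {K p p' f g : ℝ → ℝ} {B C D ε : ℝ}

lemma HasTaylorBound.memLp_sqrt_mul (hp : HasTaylorBound B p p') (hf : MemLp f 2 arcMeasure) :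
    MemLp (fun x => √(p x) * f x) 2 arcMeasure := by
  refine memLp_mul_of_bound (B := √(B * π))
    (continuous_sqrt.comp_aestronglyMeasurable hp.aestronglyMeasurable) (fun x hx => ?_) hf
  have hxI := Ioc_subset_Icc_self hx
  rw [abs_of_nonneg (sqrt_nonneg _)]
  refine sqrt_le_sqrt (((le_abs_self _).trans (hp.linear x hxI)).trans ?_)
  exact mul_le_mul_of_nonneg_left hx.2 ((abs_nonneg _).trans (hp.deriv_le x hxI))

lemma HasTaylorBound.memLp_mul (hp : HasTaylorBound B p p') (hf : MemLp f 2 arcMeasure) :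
    MemLp (fun x => p x * f x) 2 arcMeasure := by
  refine memLp_mul_of_bound (B := B * π) hp.aestronglyMeasurable (fun x hx => ?_) hf
  have hxI := Ioc_subset_Icc_self hx
  exact (hp.linear x hxI).trans
    (mul_le_mul_of_nonneg_left hx.2 ((abs_nonneg _).trans (hp.deriv_le x hxI)))

/-- Distributing `√p` evenly over both arguments costs two commutators, since
`2 u(x) (u(x) - u(y)) = (p(x) - p(y)) + (u(x) - u(y))²` for `u = √p`. -/
lemma differenceForm_mul_eq (hp : HasTaylorBound B p p') (h0 : ∀ x ∈ Icc 0 π, 0 ≤ p x)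
    (hK : Continuous K) (hC : ∀ x, |K x| ≤ C)
    (hf : MemLp f 2 arcMeasure) (hg : MemLp g 2 arcMeasure) :
    differenceForm arcMeasure K (fun x => p x * f x) g
      = differenceForm arcMeasure K (fun x => √(p x) * f x) (fun x => √(p x) * g x)
        - (∫ z : ℝ × ℝ, (K (z.1 - z.2) * (p z.1 - p z.2)) * (f z.1 * g z.2)
            ∂(arcMeasure.prod arcMeasure)) / 2
        - (∫ z : ℝ × ℝ, (K (z.1 - z.2) * (√(p z.1) - √(p z.2)) ^ 2) * (f z.1 * g z.2)
            ∂(arcMeasure.prod arcMeasure)) / 2 := by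
  have iT := integrable_differenceForm hK hC (hp.memLp_sqrt_mul hf) (hp.memLp_sqrt_mul hg)
  have iL := integrable_differenceForm hK hC (hp.memLp_mul hf) hg
  have iR : Integrable (fun z : ℝ × ℝ => (K (z.1 - z.2) * (p z.1 - p z.2)) * (f z.1 * g z.2))
      (arcMeasure.prod arcMeasure) :=
    ((integrable_conv_mul_prod hK hC (hp.memLp_mul hf) hg).sub
      (integrable_conv_mul_prod hK hC hf (hp.memLp_mul hg))).congr
      (Filter.Eventually.of_forall fun z => by simp only [Pi.sub_apply]; ring)
  have hpt : (fun z : ℝ × ℝ => (K (z.1 - z.2) * (√(p z.1) - √(p z.2)) ^ 2) * (f z.1 * g z.2))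
      =ᵐ[arcMeasure.prod arcMeasure] fun z =>
      2 * (K (z.1 - z.2) * ((√(p z.1) * f z.1) * (√(p z.1) * g z.1 - √(p z.2) * g z.2)))
      - (K (z.1 - z.2) * (p z.1 - p z.2)) * (f z.1 * g z.2)
      - 2 * (K (z.1 - z.2) * ((p z.1 * f z.1) * (g z.1 - g z.2))) :=
    ae_prod_arcMeasure fun x hx y hy => by
      have e1 := sq_sqrt (h0 x (Ioc_subset_Icc_self hx))
      have e2 := sq_sqrt (h0 y (Ioc_subset_Icc_self hy))
      dsimp only
      set s := √(p x)
      set t := √(p y)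
      rw [← e1, ← e2]
      ring
  have iTR : Integrable (fun z : ℝ × ℝ =>
      2 * (K (z.1 - z.2) * ((√(p z.1) * f z.1) * (√(p z.1) * g z.1 - √(p z.2) * g z.2)))
      - (K (z.1 - z.2) * (p z.1 - p z.2)) * (f z.1 * g z.2)) (arcMeasure.prod arcMeasure) :=
    (iT.const_mul 2).sub iR
  rw [integral_congr_ae hpt, integral_sub iTR (iL.const_mul 2),
    integral_sub (iT.const_mul 2) iR, integral_const_mul, integral_const_mul]
  unfold differenceForm
  ring

/-- The constant of the estimates for a nonnegative coefficient with bounds `B`. -/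
noncomputable def gardingConst (B : ℝ) : ℝ := π * (B ^ 2 + 1 + B) + 14 * B * π + B + 3 * B * π

lemma gardingConst_nonneg (hB : 0 ≤ B) : 0 ≤ gardingConst B := by
  unfold gardingConst; positivity

lemma abs_differenceForm_mul_sub_le (hε : 0 < ε) (hp : HasTaylorBound B p p') (hB : 0 < B)
    (h0 : ∀ x ∈ Icc 0 π, 0 ≤ p x) (hK : K = oddKernel ε ∨ K = evenKernel ε)
    (hf : MemLp f 2 arcMeasure) (hg : MemLp g 2 arcMeasure) :
    |differenceForm arcMeasure K (fun x => p x * f x) g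
      - differenceForm arcMeasure K (fun x => √(p x) * f x) (fun x => √(p x) * g x)|
      ≤ (gardingConst B - B) * ((∫ x, f x ^ 2 ∂arcMeasure) + ∫ x, g x ^ 2 ∂arcMeasure) := by
  have hN : 0 ≤ (∫ x, f x ^ 2 ∂arcMeasure) + ∫ x, g x ^ 2 ∂arcMeasure :=
    add_nonneg (integral_nonneg fun x => sq_nonneg _) (integral_nonneg fun x => sq_nonneg _)
  have hKe : ∀ x, |K x| ≤ evenKernel ε x := by
    rcases hK with rfl | rfl
    · exact abs_oddKernel_le_evenKernel hε
    · exact fun x => (abs_of_nonneg (evenKernel_nonneg ε x)).le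
  have hKc : Continuous K := by
    rcases hK with rfl | rfl
    exacts [continuous_oddKernel hε, continuous_evenKernel hε]
  have hKb : ∀ x, |K x| ≤ 1 / ε ^ 2 := fun x =>
    (hKe x).trans ((le_abs_self _).trans (abs_evenKernel_le hε x))
  have hV := abs_integral_sqrt_commutator_le hε hp hB h0 hKe hf hg
  have hR : |∫ z : ℝ × ℝ, (K (z.1 - z.2) * (p z.1 - p z.2)) * (f z.1 * g z.2)
      ∂(arcMeasure.prod arcMeasure)| ≤ (π * (B ^ 2 + 1 + B) + 5 * B * π / 2)
        * ((∫ x, f x ^ 2 ∂arcMeasure) + ∫ x, g x ^ 2 ∂arcMeasure) := by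
    rcases hK with rfl | rfl
    · refine (abs_integral_odd_commutator_le hε hp hB hf hg).trans ?_
      refine mul_le_mul_of_nonneg_right (le_add_of_nonneg_left (by positivity)) hN
    · refine (abs_integral_even_commutator_le hε hp hB hf hg).trans ?_
      refine mul_le_mul_of_nonneg_right (le_add_of_nonneg_right (by positivity)) hN
  rw [differenceForm_mul_eq hp h0 hKc hKb hf hg]
  rw [abs_le] at hV hR ⊢
  unfold gardingConst
  set N := (∫ x, f x ^ 2 ∂arcMeasure) + ∫ x, g x ^ 2 ∂arcMeasure
  have k1 : 0 ≤ π * (B ^ 2 + 1 + B) * N := by positivity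
  have k2 : 0 ≤ B * π * N := by positivity
  constructor <;> linarith

/-- For a nonnegative coefficient, both mixed forms are dominated by the energies of the two
arguments. -/
lemma abs_differenceForm_mul_le (hε : 0 < ε) (hp : HasTaylorBound B p p') (hB : 0 < B)
    (h0 : ∀ x ∈ Icc 0 π, 0 ≤ p x) (hK : K = oddKernel ε ∨ K = evenKernel ε)
    (hf : MemLp f 2 arcMeasure) (hg : MemLp g 2 arcMeasure) :
    |differenceForm arcMeasure K (fun x => p x * f x) g|
      ≤ (differenceForm arcMeasure (evenKernel ε) (fun x => p x * f x) f
          + differenceForm arcMeasure (evenKernel ε) (fun x => p x * g x) g) / 2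
        + 2 * gardingConst B * ((∫ x, f x ^ 2 ∂arcMeasure) + ∫ x, g x ^ 2 ∂arcMeasure) := by
  have hF := hp.memLp_sqrt_mul hf
  have hG := hp.memLp_sqrt_mul hg
  have hN1 : 0 ≤ ∫ x, f x ^ 2 ∂arcMeasure := integral_nonneg fun x => sq_nonneg _
  have hN2 : 0 ≤ ∫ x, g x ^ 2 ∂arcMeasure := integral_nonneg fun x => sq_nonneg _
  have e1 := abs_differenceForm_mul_sub_le hε hp hB h0 hK hf hg
  have e2 := abs_differenceForm_mul_sub_le hε hp hB h0 (Or.inr rfl) hf hf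
  have e3 := abs_differenceForm_mul_sub_le hε hp hB h0 (Or.inr rfl) hg hg
  have e4 : |differenceForm arcMeasure K (fun x => √(p x) * f x) (fun x => √(p x) * g x)|
      ≤ (differenceForm arcMeasure (evenKernel ε) (fun x => √(p x) * f x) (fun x => √(p x) * f x)
        + differenceForm arcMeasure (evenKernel ε) (fun x => √(p x) * g x)
            (fun x => √(p x) * g x)) / 2
        + B * ((∫ x, f x ^ 2 ∂arcMeasure) + ∫ x, g x ^ 2 ∂arcMeasure) := by
    rcases hK with rfl | rfl
    · refine abs_differenceForm_oddKernel_le hε hB.le (fun x hx => ?_) (fun x hx h4 => ?_)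
        hf hg hF hG
      · have hxI := Ioc_subset_Icc_self hx
        rw [sq_sqrt (h0 x hxI)]
        exact (le_abs_self _).trans (hp.linear x hxI)
      · rw [hp.support x (Ioc_subset_Icc_self hx) h4, sqrt_zero]
    · refine (abs_differenceForm_le (continuous_evenKernel hε) (abs_evenKernel_le hε)
        (evenKernel_neg ε) (evenKernel_nonneg ε) hF hG).trans ?_
      exact le_add_of_nonneg_right (by positivity)
  have hBX : 0 ≤ B * ((∫ x, f x ^ 2 ∂arcMeasure) + ∫ x, g x ^ 2 ∂arcMeasure) := by positivity
  rw [abs_le] at e1 e2 e3 e4 ⊢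
  constructor <;> linarith

end NonnegCoefficient

/-! ### The refined Gårding inequality -/

/-- On `[0, π]` the iterated integral is a single integral against the product measure. -/
lemma kernelForm_eq_differenceForm {K c f g : ℝ → ℝ} {C : ℝ} (hK : Continuous K)
    (hC : ∀ x, |K x| ≤ C) (hf : MemLp (fun x => c x * f x) 2 arcMeasure)
    (hg : MemLp g 2 arcMeasure) :
    kernelForm K c f g = differenceForm arcMeasure K (fun x => c x * f x) g := by
  unfold kernelForm differenceForm
  rw [integral_prod _ (integrable_differenceForm hK hC hf hg),
    intervalIntegral.integral_of_le pi_pos.le]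
  refine integral_congr_ae (Filter.Eventually.of_forall fun x => ?_)
  dsimp only
  rw [intervalIntegral.integral_of_le pi_pos.le, ← integral_const_mul]
  exact integral_congr_ae (Filter.Eventually.of_forall fun y => by dsimp only; ring)

lemma differenceForm_linear_left {K F₁ F₂ G : ℝ → ℝ} {C : ℝ} (a b : ℝ) (hK : Continuous K)
    (hC : ∀ x, |K x| ≤ C) (h₁ : MemLp F₁ 2 arcMeasure) (h₂ : MemLp F₂ 2 arcMeasure)
    (hG : MemLp G 2 arcMeasure) :
    differenceForm arcMeasure K (fun x => a * F₁ x + b * F₂ x) G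
      = a * differenceForm arcMeasure K F₁ G + b * differenceForm arcMeasure K F₂ G := by
  unfold differenceForm
  rw [← integral_const_mul, ← integral_const_mul,
    ← integral_add ((integrable_differenceForm hK hC h₁ hG).const_mul a)
      ((integrable_differenceForm hK hC h₂ hG).const_mul b)]
  exact integral_congr_ae (Filter.Eventually.of_forall fun z => by dsimp only; ring)

lemma IsL2Supported.memLp_arcMeasure {f : ℝ → ℝ} (hf : IsL2Supported f) :
    MemLp f 2 arcMeasure :=
  hf.memLp.mono_measure (Measure.restrict_mono Ioc_subset_Icc_self le_rfl)

/-- Split `c = p - q` and `c̃ = 9 (p + q)` with the nonnegative coefficients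
`p, q = (c̃/9 ± c)/2`, and apply the estimate for nonnegative coefficients to each. -/
lemma kernelForm_le {A ε : ℝ} {K c ctilde f g : ℝ → ℝ} (hc : IsCoeff A c) (hct : IsCoeff A ctilde)
    (h9 : ∀ x ∈ Icc (0 : ℝ) π, 9 * |c x| ≤ ctilde x) (hf : IsL2Supported f) (hg : IsL2Supported g)
    (hε : 0 < ε) (hK : K = oddKernel ε ∨ K = evenKernel ε) :
    kernelForm K c f g ≤ kernelForm (evenKernel ε) ctilde f f
      + kernelForm (evenKernel ε) ctilde g g
      + 72 * gardingConst (A + 1)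
        * ((∫ x in (0 : ℝ)..π, f x ^ 2) + ∫ x in (0 : ℝ)..π, g x ^ 2) := by
  have hA := hc.nonneg
  have hB : 0 < A + 1 := by linarith
  have Tc := hc.hasTaylorBound
  have Tt := hct.hasTaylorBound
  have hp := Tt.combine (B := A + 1) (a := 1 / 18) (b := 1 / 2) Tc (by
    rw [abs_of_pos (by norm_num), abs_of_pos (by norm_num)]; linarith)
  have hq := Tt.combine (B := A + 1) (a := 1 / 18) (b := -(1 / 2)) Tc (by
    rw [abs_neg, abs_of_pos (by norm_num), abs_of_pos (by norm_num)]; linarith)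
  have hp0 : ∀ x ∈ Icc 0 π, 0 ≤ 1 / 18 * ctilde x + 1 / 2 * c x := fun x hx => by
    linarith [h9 x hx, neg_abs_le (c x)]
  have hq0 : ∀ x ∈ Icc 0 π, 0 ≤ 1 / 18 * ctilde x + -(1 / 2) * c x := fun x hx => by
    linarith [h9 x hx, le_abs_self (c x)]
  have hf' := hf.memLp_arcMeasure
  have hg' := hg.memLp_arcMeasure
  have hKe : ∀ x, |K x| ≤ 1 / ε ^ 2 := by
    rcases hK with rfl | rfl
    · exact fun x => (abs_oddKernel_le_evenKernel hε x).trans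
        ((le_abs_self _).trans (abs_evenKernel_le hε x))
    · exact abs_evenKernel_le hε
  have hKc : Continuous K := by
    rcases hK with rfl | rfl
    exacts [continuous_oddKernel hε, continuous_evenKernel hε]
  have cE := continuous_evenKernel hε
  have bE := abs_evenKernel_le hε
  have P := abs_differenceForm_mul_le hε hp hB hp0 hK hf' hg'
  have Q := abs_differenceForm_mul_le hε hq hB hq0 hK hf' hg'
  have split : ∀ {L h₁ h₂ : ℝ → ℝ} (b : ℝ), Continuous L → (∀ x, |L x| ≤ 1 / ε ^ 2) →
      MemLp h₁ 2 arcMeasure → MemLp h₂ 2 arcMeasure →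
      differenceForm arcMeasure L (fun x => (1 / 18 * ctilde x + b * c x) * h₁ x) h₂
        = 1 / 18 * kernelForm L ctilde h₁ h₂ + b * kernelForm L c h₁ h₂ := by
    intro L h₁ h₂ b hL hL' m₁ m₂
    rw [kernelForm_eq_differenceForm hL hL' (Tt.memLp_mul m₁) m₂,
      kernelForm_eq_differenceForm hL hL' (Tc.memLp_mul m₁) m₂,
      ← differenceForm_linear_left _ _ hL hL' (Tt.memLp_mul m₁) (Tc.memLp_mul m₁) m₂]
    congr 1; funext x; ring
  rw [split _ hKc hKe hf' hg', split _ cE bE hf' hf', split _ cE bE hg' hg', abs_le] at P Q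
  rw [intervalIntegral.integral_of_le pi_pos.le, intervalIntegral.integral_of_le pi_pos.le]
  have hN : 0 ≤ gardingConst (A + 1)
      * ((∫ x, f x ^ 2 ∂arcMeasure) + ∫ x, g x ^ 2 ∂arcMeasure) :=
    mul_nonneg (gardingConst_nonneg hB.le) (add_nonneg (integral_nonneg fun x => sq_nonneg _)
      (integral_nonneg fun x => sq_nonneg _))
  linarith [P.1, P.2, Q.1, Q.2]

theorem lemma4p10 (A : ℝ) :
    ∃ M : ℝ, ∀ c ctilde : ℝ → ℝ, IsCoeff A c → IsCoeff A ctilde →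
      (∀ x ∈ Icc (0 : ℝ) π, 9 * |c x| ≤ ctilde x) →
      ∀ f g : ℝ → ℝ, IsL2Supported f → IsL2Supported g →
      ∀ ε : ℝ, 0 < ε →
        kernelForm (oddKernel ε) c f g ≤
            kernelForm (evenKernel ε) ctilde f f + kernelForm (evenKernel ε) ctilde g g
              + M * ((∫ x in (0 : ℝ)..π, f x ^ 2) + ∫ x in (0 : ℝ)..π, g x ^ 2) ∧
        kernelForm (evenKernel ε) c f g ≤
            kernelForm (evenKernel ε) ctilde f f + kernelForm (evenKernel ε) ctilde g g
              + M * ((∫ x in (0 : ℝ)..π, f x ^ 2) + ∫ x in (0 : ℝ)..π, g x ^ 2) :=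
  ⟨72 * gardingConst (A + 1), fun _ _ hc hct h9 _ _ hf hg _ hε =>
    ⟨kernelForm_le hc hct h9 hf hg hε (Or.inl rfl), kernelForm_le hc hct h9 hf hg hε (Or.inr rfl)⟩⟩
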